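/- Let $m\ge 3$ and $d\ge 0$ be integers and let $\mathcal X=[0,\pi]^{m-2}\times[-\pi,\pi]$ be the set of hyperspherical coordinates $(\boldsymbol\theta,\phi)=(\theta_1,\dots,\theta_{m-2},\phi)$ of the unit sphere of $\mathbb R^m$. For integers $\lambda=\mu_0\ge\mu_1\ge\dots\ge\mu_{m-3}\ge 0$ and $-\mu_{m-3}\le\mu_{m-2}\le\mu_{m-3}$ the real hyperspherical harmonic of level $\lambda$ is, with $u=|\mu_{m-2}|$, $$Y_{\mu_0,\dots,\mu_{m-2}}(\boldsymbol\theta,\phi)=A\prod_{i=1}^{m-3}\Big[C_{\mu_{i-1}-\mu_i}^{\mu_i+\frac{m-i-1}2}(\cos\theta_i)(\sin\theta_i)^{\mu_i}\Big]\;B\,P_{\mu_{m-3}}^{u}(\cos\theta_{m-2})\cdot\begin{cases}\cos(u\phi)&\mu_{m-2}>0\\ \sin(u\phi)&\mu_{m-2}<0\\ 1/\sqrt2&\mu_{m-2}=0,\end{cases}$$ where $C_k^\alpha$ are the Gegenbauer polynomials, $P_l^u(\cos\theta)=(-1)^u\frac{(2u)!}{2^uu!}(\sin\theta)^uC_{l-u}^{u+1/2}(\cos\theta)$,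 $$A=\prod_{i=1}^{m-3}\Big[\tfrac{2^{2\mu_i+m-i-3}(\mu_{i-1}-\mu_i)!\,(2\mu_{i-1}+m-i-1)\,\Gamma^2(\mu_i+\frac{m-i-1}2)}{\pi(\mu_{i-1}+\mu_i+m-i-2)!}\Big]^{1/2},\qquad B=\Big[\tfrac{2(2\mu_{m-3}+1)(\mu_{m-3}-u)!}{4\pi(\mu_{m-3}+u)!}\Big]^{1/2}.$$ Let $f_d$ be the vector of all these functions with $\lambda\le d$, let $D$ be its length, and consider the regression model $E[Y|\boldsymbol\theta,\phi]=f_d^T(\boldsymbol\theta,\phi)\,\boldsymbol c$, $\boldsymbol c\in\mathbb R^D$. A design is a Borel probability measure $\xi$ on $\mathcal X$; its information matrix is $M(\xi)=\int f_df_d^T\,d\xi$. For a $D\times s$ matrix $K$ of rank $s$, $K^T\boldsymbol c$ is estimable under $\xi$ if $\operatorname{range}K\subset\operatorname{range}M(\xi)$; then $C_K(\xi)=(K^TM(\xi)^-K)^{-1}$, where $M^-$ is a generalized inverse (the choice does not matter). For $-\infty\le p<1$ let $\Phi_p(\xi)=(\operatorname{tr}C_K(\xi)^p)^{1/p}$ if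 $p\ne0,-\infty$, $\Phi_0(\xi)=(\det C_K(\xi))^{1/s}$, and let $\Phi_{-\infty}(\xi)$ be the smallest eigenvalue of $C_K(\xi)$. A design is $\Phi_p$-optimal for estimating $K^T\boldsymbol c$ if $K^T\boldsymbol c$ is estimable under it and it maximises $\Phi_p$ among all designs under which $K^T\boldsymbol c$ is estimable. For $1\le s\le D$ a design is $\Phi_{E_s}$-optimal if it maximises, among all designs, the sum $\Phi_{E_s}(\xi)$ of the $s$ smallest eigenvalues (with multiplicity) of $M(\xi)$. Put $s(k)=\frac{(m+2k-2)(k+m-3)!}{k!(m-2)!}$ and let $\xi^*$ be the uniform distribution on the sphere, that is, the measure on $\mathcal X$ with Lebesgue density $\frac1{\tilde\Omega}\prod_{i=1}^{m-2}(\sin\theta_i)^{m-1-i}$, where $\tilde\Omega=\int_{\mathcal X}\prod_{i=1}^{m-2}(\sin\theta_i)^{m-1-i}\,d\boldsymbol\theta\,d\phi$. **Theorem.** $D=\sum_{\lambda=0}^d s(\lambda)$; $\tilde\Omega=\frac{N_m}{(m-2)!!}$ with $N_m=\frac{2(m-2)!!\,\pi^{m/2}}{\Gamma(m/2)}$; $\xi^*$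 is a design; and (i) $M(\xi^*)=\frac1{\tilde\Omega}I_D$. Moreover let $q\ge0$ and $0\le k_0<k_1<\dots<k_q\le d$ be integers and let $K$ be the matrix for which $K^T\boldsymbol c$ consists of the coefficients of the harmonics of the levels $k_0,\dots,k_q$: $K^T$ has blocks $K_{j,l}$ ($0\le j\le q$, $0\le l\le d$) with $K_{j,k_j}=I_{s(k_j)}$ and $K_{j,l}=0$ for $l\ne k_j$. Then $K$ has $s=\sum_{j=0}^qs(k_j)$ columns, and (ii) for every $p\in[-\infty,1)$ the design $\xi^*$ is $\Phi_p$-optimal for estimating $K^T\boldsymbol c$; (iii) $\xi^*$ is $\Phi_{E_s}$-optimal for $s=\sum_{j=0}^qs(k_j)$. -/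

import Mathlib

/-! Approximate designs, information matrices and Kiefer's criteria for a linear regression model
with finitely many regression functions, followed by the real hyperspherical harmonics. -/

namespace OptDesign

noncomputable section

open MeasureTheory Matrix

variable {X ι κ : Type*} [MeasurableSpace X]

/-- An approximate design on the design space `S`: a probability measure concentrated on `S`. -/
def IsDesign (S : Set X) (ξ : Measure X) : Prop :=
  IsProbabilityMeasure ξ ∧ ξ Sᶜ = 0

/-- The information matrix `M(ξ) = ∫ f fᵀ dξ` of the design `ξ` in the regression model with
regression functions `f a`, `a : ι`. -/
def infoMatrix (f : ι → X → ℝ) (ξ : Measure X) : Matrix ι ι ℝ :=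
  Matrix.of fun a b => ∫ x, f a x * f b x ∂ξ

theorem isHermitian_infoMatrix (f : ι → X → ℝ) (ξ : Measure X) :
    (infoMatrix f ξ).IsHermitian := by
  ext a b
  simp [infoMatrix, Matrix.conjTranspose_apply, mul_comm]

section Criteria

variable [Fintype ι] [DecidableEq ι] [Fintype κ] [DecidableEq κ]

/-- The (Moore-Penrose) generalized inverse of a symmetric real matrix: eigenvalues are inverted,
and the eigenvalue `0` is kept. -/
def genInv (M : Matrix ι ι ℝ) : Matrix ι ι ℝ := cfc (fun x : ℝ => x⁻¹) M

theorem mul_genInv_mul {M : Matrix ι ι ℝ} (hM : M.IsHermitian) : M * genInv M * M = M := by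
  have hsa : IsSelfAdjoint M := hM
  have hfin : (spectrum ℝ M).Finite := Matrix.finite_real_spectrum
  have hc : ∀ g : ℝ → ℝ, ContinuousOn g (spectrum ℝ M) := fun g => hfin.continuousOn g
  have hid : cfc (fun x : ℝ => x) M = M := cfc_id' ℝ M
  calc M * genInv M * M
      = cfc (fun x : ℝ => x) M * cfc (fun x : ℝ => x⁻¹) M * cfc (fun x : ℝ => x) M := by
        rw [hid, genInv]
    _ = cfc (fun x : ℝ => x * x⁻¹ * x) M := by
        rw [← cfc_mul _ _ M (hc _) (hc _), ← cfc_mul _ _ M (hc _) (hc _)]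
    _ = M := by
        simp only [mul_inv_mul_cancel]
        exact hid

/-- `Kᵀ c` is estimable under `ξ`: `range K ⊆ range M(ξ)`. -/
def Estimable (f : ι → X → ℝ) (K : Matrix ι κ ℝ) (ξ : Measure X) : Prop :=
  LinearMap.range K.mulVecLin ≤ LinearMap.range (infoMatrix f ξ).mulVecLin

/-- The matrix `C_K(ξ) = (Kᵀ M(ξ)⁻ K)⁻¹`. -/
def cMatrix (f : ι → X → ℝ) (K : Matrix ι κ ℝ) (ξ : Measure X) : Matrix κ κ ℝ :=
  (Kᵀ * genInv (infoMatrix f ξ) * K)⁻¹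

/-- For estimable `Kᵀ c` the matrix `C_K(ξ)` does not depend on the generalized inverse used. -/
theorem cMatrix_eq_of_isGenInv (f : ι → X → ℝ) (K : Matrix ι κ ℝ) (ξ : Measure X)
    (h : Estimable f K ξ) (G : Matrix ι ι ℝ)
    (hG : infoMatrix f ξ * G * infoMatrix f ξ = infoMatrix f ξ) :
    cMatrix f K ξ = (Kᵀ * G * K)⁻¹ := by
  have hM := isHermitian_infoMatrix f ξ
  set M := infoMatrix f ξ with hMdef
  have hMt : Mᵀ = M := by rw [← Matrix.conjTranspose_eq_transpose_of_trivial]; exact hM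
  have hx : ∀ j : κ, ∃ v : ι → ℝ, M *ᵥ v = K.col j := by
    intro j
    have : K.col j ∈ LinearMap.range K.mulVecLin :=
      ⟨Pi.single j 1, by simp⟩
    obtain ⟨v, hv⟩ := h this
    exact ⟨v, by simpa [← hMdef] using hv⟩
  choose v hv using hx
  have hK : K = M * (Matrix.of v)ᵀ := by
    ext i j
    have := congrFun (hv j) i
    simpa [Matrix.mul_apply, Matrix.mulVec, dotProduct, Matrix.col] using this.symm
  have key : ∀ G' : Matrix ι ι ℝ, M * G' * M = M →
      Kᵀ * G' * K = Matrix.of v * M * (Matrix.of v)ᵀ := by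
    intro G' hG'
    calc Kᵀ * G' * K = Matrix.of v * (M * G' * M) * (Matrix.of v)ᵀ := by
          rw [hK, Matrix.transpose_mul, hMt, Matrix.transpose_transpose]
          simp only [Matrix.mul_assoc]
      _ = _ := by rw [hG']
  unfold cMatrix
  rw [← hMdef, key _ (mul_genInv_mul hM), key _ hG]

/-- Kiefer's criterion `Φ_p` as a function of the positive definite matrix `C = C_K(ξ)`, for
`-∞ ≤ p < 1`: the smallest eigenvalue for `p = -∞` (E-criterion), `(det C)^(1/s)` for `p = 0`
(D-criterion, `s` being the size of `C`), and `(tr C^p)^(1/p)` otherwise, where `C^p` is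
the spectral power. -/
def kiefer (p : EReal) (C : Matrix κ κ ℝ) : ℝ :=
  if p = ⊥ then sInf (spectrum ℝ C)
  else if p = 0 then C.det ^ (1 / (Fintype.card κ : ℝ))
  else (cfc (fun x : ℝ => x ^ p.toReal) C).trace ^ (1 / p.toReal)

/-- `ξ` is `Φ_p`-optimal for estimating `Kᵀ c`: it maximises `Φ_p` among all designs on `S` for
which `Kᵀ c` is estimable. -/
def IsPhiOptimal (f : ι → X → ℝ) (S : Set X) (K : Matrix ι κ ℝ) (p : EReal)
    (ξ : Measure X) : Prop :=
  IsDesign S ξ ∧ Estimable f K ξ ∧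
    ∀ η : Measure X, IsDesign S η → Estimable f K η →
      kiefer p (cMatrix f K η) ≤ kiefer p (cMatrix f K ξ)

/-- The eigenvalues of `M(ξ)` (with multiplicity) in nondecreasing order, with indices from `0`. -/
def sortedEigenvalue (f : ι → X → ℝ) (ξ : Measure X) (i : Fin (Fintype.card ι)) : ℝ :=
  (isHermitian_infoMatrix f ξ).eigenvalues₀ i.rev

/-- `Φ_{E_s}(ξ)`: the sum of the `s` smallest eigenvalues of `M(ξ)`. -/
def phiE (f : ι → X → ℝ) (s : ℕ) (ξ : Measure X) : ℝ :=
  ∑ i : Fin (Fintype.card ι) with i.val < s, sortedEigenvalue f ξ i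

/-- `ξ` is `Φ_{E_s}`-optimal: `1 ≤ s ≤ D` and `ξ` maximises `Φ_{E_s}` among all designs on `S`. -/
def IsPhiEOptimal (f : ι → X → ℝ) (S : Set X) (s : ℕ) (ξ : Measure X) : Prop :=
  (1 ≤ s ∧ s ≤ Fintype.card ι) ∧ IsDesign S ξ ∧
    ∀ η : Measure X, IsDesign S η → phiE f s η ≤ phiE f s ξ

end Criteria

end

end OptDesign

namespace Hyperspherical

noncomputable section

open MeasureTheory Polynomial

/-- The Gegenbauer polynomial `C_k^α(x) = ∑_{j ≤ k/2} (-1)^j (α)_{k-j} / (j! (k-2j)!) (2x)^(k-2j)`,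
where `(α)_r` is the rising factorial. -/
def gegenbauer (k : ℕ) (α : ℝ) : ℝ[X] :=
  ∑ j ∈ Finset.range (k / 2 + 1),
    Polynomial.C ((-1) ^ j * (ascPochhammer ℝ (k - j)).eval α /
      ((j.factorial : ℝ) * ((k - 2 * j).factorial : ℝ))) * (2 * Polynomial.X) ^ (k - 2 * j)

/-- The associated Legendre function `P_l^u(cos t)`, including the sign `(-1)^u`. -/
def legendreCos (l u : ℕ) (t : ℝ) : ℝ :=
  (-1) ^ u * ((2 * u).factorial : ℝ) / (2 ^ u * (u.factorial : ℝ)) * Real.sin t ^ u *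
    (gegenbauer (l - u) (u + 1 / 2)).eval (Real.cos t)

/-- The `i`-th factor (`1 ≤ i ≤ m - 3`) of the normalising constant `A`, with
`a = μ_{i-1} ≥ b = μ_i`. -/
def constA (m i a b : ℕ) : ℝ :=
  √(2 ^ (2 * b + m - i - 3) * ((a - b).factorial : ℝ) * (2 * a + m - i - 1) *
      Real.Gamma (b + ((m : ℝ) - i - 1) / 2) ^ 2 /
    (Real.pi * ((a + b + m - i - 2).factorial : ℝ)))

/-- The normalising constant `B_{l,u}`, `l ≥ u`. -/
def constB (l u : ℕ) : ℝ :=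
  √(2 * (2 * l + 1) * ((l - u).factorial : ℝ) / (4 * Real.pi * ((l + u).factorial : ℝ)))

/-- Angular coordinates on the unit sphere of `ℝ^m`, `m = n + 3`: the pair
`((θ_1, …, θ_{m-2}), φ)`, where `θ_i` is the component with index `i - 1`. -/
abbrev Angles (n : ℕ) : Type := (Fin (n + 1) → ℝ) × ℝ

/-- The design space `[0, π]^(m-2) × [-π, π]`, `m = n + 3`. -/
def angleBox (n : ℕ) : Set (Angles n) :=
  (Set.univ.pi fun _ => Set.Icc 0 Real.pi) ×ˢ Set.Icc (-Real.pi) Real.pi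

/-- The multi-indices `((μ_0, …, μ_{m-3}), μ_{m-2})`, `m = n + 3`, of the real hyperspherical
harmonics up to order `d`, where `μ_0 = λ` is the level:
`d ≥ μ_0 ≥ μ_1 ≥ … ≥ μ_{m-3} ≥ 0` and `-μ_{m-3} ≤ μ_{m-2} ≤ μ_{m-3}`. -/
def indexSet (n d : ℕ) : Finset ((Fin (n + 1) → ℕ) × ℤ) :=
  ((Fintype.piFinset fun _ => Finset.range (d + 1)) ×ˢ Finset.Icc (-(d : ℤ)) d).filter
    fun a => (∀ i : Fin n, a.1 i.succ ≤ a.1 i.castSucc) ∧ |a.2| ≤ (a.1 (Fin.last n) : ℤ)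

/-- The index type of the regression functions. -/
abbrev Index (n d : ℕ) : Type := indexSet n d

/-- The level `λ = μ_0` of an index. -/
def level {n d : ℕ} (a : Index n d) : ℕ := a.1.1 0

/-- The real hyperspherical harmonic `Y_{μ_0, …, μ_{m-3}, ν}(θ, φ)`, `m = n + 3`. -/
def hyperHarmonic (n : ℕ) (μ : Fin (n + 1) → ℕ) (ν : ℤ) (x : Angles n) : ℝ :=
  (∏ i : Fin n,
    constA (n + 3) (i + 1) (μ i.castSucc) (μ i.succ) *
      ((gegenbauer (μ i.castSucc - μ i.succ)
          (μ i.succ + (((n + 3 : ℕ) : ℝ) - ((i + 1 : ℕ) : ℝ) - 1) / 2)).eval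
            (Real.cos (x.1 i.castSucc)) *
        Real.sin (x.1 i.castSucc) ^ μ i.succ)) *
  (constB (μ (Fin.last n)) ν.natAbs *
    legendreCos (μ (Fin.last n)) ν.natAbs (x.1 (Fin.last n))) *
  (if 0 < ν then Real.cos (ν.natAbs * x.2)
    else if ν < 0 then Real.sin (ν.natAbs * x.2)
    else 1 / √2)

/-- The regression functions: all real hyperspherical harmonics up to order `d`. -/
def regressors (n d : ℕ) (a : Index n d) : Angles n → ℝ :=
  hyperHarmonic n a.1.1 a.1.2

/-- The density `(sin θ_1)^(m-2) (sin θ_2)^(m-3) ⋯ sin θ_{m-2}` of the solid angle `Ω_m`. -/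
def solidAngle (n : ℕ) (x : Angles n) : ℝ :=
  ∏ i : Fin (n + 1), Real.sin (x.1 i) ^ (n + 1 - (i : ℕ))

/-- The total solid angle. -/
def totalAngle (n : ℕ) : ℝ := ∫ x in angleBox n, solidAngle n x

/-- The uniform distribution on the sphere in angular coordinates: the measure on the design space
with Lebesgue density `solidAngle / totalAngle`. -/
def uniformDesign (n : ℕ) : Measure (Angles n) :=
  (volume.restrict (angleBox n)).withDensity fun x =>
    ENNReal.ofReal (solidAngle n x / totalAngle n)

/-- The number `s(k) = (m+2k-2) (k+m-3)! / (k! (m-2)!)`; for `m ≥ 3` the division is exact, see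
`levelDim_exact`. -/
def levelDim (m k : ℕ) : ℕ :=
  (m + 2 * k - 2) * (k + m - 3).factorial / (k.factorial * (m - 2).factorial)

theorem levelDim_exact (m k : ℕ) (hm : 3 ≤ m) :
    k.factorial * (m - 2).factorial ∣ (m + 2 * k - 2) * (k + m - 3).factorial := by
  obtain ⟨n, rfl⟩ : ∃ n, m = n + 3 := ⟨m - 3, by omega⟩
  have e1 : n + 3 + 2 * k - 2 = (k + (n + 1)) + k := by omega
  have e2 : k + (n + 3) - 3 = k + n := by omega
  have e3 : n + 3 - 2 = n + 1 := by omega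
  rw [e1, e2, e3, add_mul]
  have h1 : (k + (n + 1)) * (k + n).factorial = (k + (n + 1)).factorial := by
    rw [← add_assoc, Nat.factorial_succ]
  refine dvd_add ?_ ?_
  · rw [h1]
    exact Nat.factorial_mul_factorial_dvd_factorial_add k (n + 1)
  · rcases k with _ | k
    · simp
    · have h2 := Nat.factorial_mul_factorial_dvd_factorial_add k (n + 1)
      rw [Nat.factorial_succ, mul_assoc, show k + 1 + n = k + (n + 1) by omega]
      exact Nat.mul_dvd_mul_left _ h2

/-- The coefficients selected by the levels `k_0, …, k_q`, in blocks: block `j` consists of the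
indices of level `k_j`. -/
abbrev Selected (n d : ℕ) {q : ℕ} (k : Fin (q + 1) → ℕ) : Type :=
  Σ j : Fin (q + 1), {a : Index n d // level a = k j}

/-- The matrix `K`: block `(j, l)` of `Kᵀ` is the identity if `l = k_j`, and zero otherwise. -/
def selection (n d : ℕ) {q : ℕ} (k : Fin (q + 1) → ℕ) : Matrix (Index n d) (Selected n d k) ℝ :=
  Matrix.of fun a b => if a = b.2.1 then 1 else 0

end

end Hyperspherical

/-! Two facts about the harmonics carry everything: they are orthonormal for the solid angle, and
the sum of their squares over one level is a constant function (the addition theorem on the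
diagonal). Orthonormality gives `infoMatrix_uniformDesign`, so under the uniform design all the
matrices involved are multiples of the identity. The addition theorem gives
`sum_selected_infoMatrix`: the trace of the selected block of M(η) is the same for every design η.

Optimality is then linear algebra. Since KᵀK = 1, the Gauss–Markov inequality bounds tr C_K(η) by
the trace of that block, and at given trace a scalar matrix is best for every Φ_p, by Jensen or
AM–GM on the eigenvalues (`kiefer_le_kiefer_smul_one`). For Φ_{E_s}, Ky Fan's inequality
(`phiE_le_sum_diag`) bounds the sum of the s smallest eigenvalues by the same trace.

The analytic facts reduce to one variable. By `hyperHarmonic_eq_prod` a harmonic is a product of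
normalised functions of single angles, each polar factor depending on two consecutive indices.
Orthonormality follows by Fubini. The addition theorem follows by induction on the dimension: the
harmonics of level l are those of levels b ≤ l one dimension lower, times a polar factor, and the
weighted sum of squared polar factors over b is constant because its derivative telescopes
(`exists_sum_ultraspherical_sq_eq`). -/

namespace OptDesign

open MeasureTheory Matrix

/-! ### Optimality of a design whose information matrix is scalar. -/

section

variable {X ι κ : Type*} [MeasurableSpace X] [Fintype ι]

theorem posSemidef_infoMatrix {f : ι → X → ℝ} {η : Measure X}
    (hf : ∀ a b, Integrable (fun x => f a x * f b x) η) : (infoMatrix f η).PosSemidef := by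
  refine Matrix.PosSemidef.of_dotProduct_mulVec_nonneg (isHermitian_infoMatrix f η) fun v => ?_
  have h : star v ⬝ᵥ infoMatrix f η *ᵥ v = ∫ x, (∑ a, v a * f a x) ^ 2 ∂η := by
    have e : ∀ x, (∑ a, v a * f a x) ^ 2 = ∑ a, ∑ b, v a * v b * (f a x * f b x) := by
      intro x
      rw [sq, Finset.sum_mul_sum]
      exact Finset.sum_congr rfl fun a _ => Finset.sum_congr rfl fun b _ => by ring
    simp_rw [e]
    rw [integral_finsetSum _ fun a _ => integrable_finsetSum _ fun b _ => (hf a b).const_mul _]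
    simp only [dotProduct, mulVec, infoMatrix, Matrix.of_apply, Pi.star_apply, star_trivial]
    refine Finset.sum_congr rfl fun a _ => ?_
    rw [integral_finsetSum _ fun b _ => (hf a b).const_mul _, Finset.mul_sum]
    refine Finset.sum_congr rfl fun b _ => ?_
    rw [integral_const_mul]
    ring
  rw [h]
  exact integral_nonneg fun x => sq_nonneg _

variable [Fintype κ] [DecidableEq κ]

theorem Estimable.exists_eq_mul {f : ι → X → ℝ} {K : Matrix ι κ ℝ} {η : Measure X}
    (h : Estimable f K η) : ∃ V : Matrix ι κ ℝ, K = infoMatrix f η * V := by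
  have hx : ∀ j : κ, ∃ v : ι → ℝ, infoMatrix f η *ᵥ v = K.col j := by
    intro j
    obtain ⟨v, hv⟩ := h (show K.col j ∈ LinearMap.range K.mulVecLin from ⟨Pi.single j 1, by simp⟩)
    exact ⟨v, by simpa using hv⟩
  choose v hv using hx
  refine ⟨(Matrix.of v)ᵀ, ?_⟩
  ext i j
  simpa [Matrix.mul_apply, Matrix.mulVec, dotProduct, Matrix.col] using (congrFun (hv j) i).symm

variable [DecidableEq ι]

/-- The Gauss–Markov inequality: if `Kᵀ K = 1`, then `C_K(η) ≤ Kᵀ M(η) K`. -/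
theorem cMatrix_posDef_and_trace_le {f : ι → X → ℝ} {K : Matrix ι κ ℝ} {η : Measure X}
    (hf : ∀ a b, Integrable (fun x => f a x * f b x) η) (hK : Kᵀ * K = 1)
    (h : Estimable f K η) :
    (cMatrix f K η).PosDef ∧ (cMatrix f K η).trace ≤ (Kᵀ * infoMatrix f η * K).trace := by
  have hM := posSemidef_infoMatrix hf
  obtain ⟨V, hV⟩ := h.exists_eq_mul
  have hgen := mul_genInv_mul (isHermitian_infoMatrix f η)
  unfold cMatrix
  set M := infoMatrix f η with hMdef
  have hMt : Mᵀ = M := by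
    rw [← Matrix.conjTranspose_eq_transpose_of_trivial]
    exact isHermitian_infoMatrix f η
  have hVK : Vᵀ * M = Kᵀ := by rw [hV, Matrix.transpose_mul, hMt]
  have hN : Kᵀ * genInv M * K = Vᵀ * M * V := by
    calc Kᵀ * genInv M * K = Vᵀ * (M * genInv M * M) * V := by
          rw [hV, Matrix.transpose_mul, hMt]
          simp only [Matrix.mul_assoc]
      _ = _ := by rw [hgen]
  rw [hN]
  have hNpsd : (Vᵀ * M * V).PosSemidef := by
    simpa [Matrix.conjTranspose_eq_transpose_of_trivial] using hM.conjTranspose_mul_mul_same V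
  have hNpd : (Vᵀ * M * V).PosDef := by
    refine (hNpsd.posDef_iff_isUnit).2 ?_
    rw [← Matrix.mulVec_injective_iff_isUnit]
    refine (injective_iff_map_eq_zero (Vᵀ * M * V).mulVecLin).2 fun x hx => ?_
    -- A kernel vector x of VᵀMV makes the form of M vanish at Vx, so MVx = Kx = 0, and then x =
    -- KᵀKx = 0.
    have h0 : star (V *ᵥ x) ⬝ᵥ M *ᵥ (V *ᵥ x) = 0 := by
      have : x ⬝ᵥ (Vᵀ * M * V) *ᵥ x = 0 := by
        have : (Vᵀ * M * V) *ᵥ x = 0 := hx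
        rw [this, dotProduct_zero]
      rw [← this, star_trivial, ← Matrix.mulVec_mulVec, ← Matrix.mulVec_mulVec,
        Matrix.dotProduct_mulVec x, Matrix.vecMul_transpose]
    have h1 : M *ᵥ (V *ᵥ x) = 0 := (hM.dotProduct_mulVec_zero_iff _).1 h0
    rw [Matrix.mulVec_mulVec, ← hV] at h1
    have := congrArg (Kᵀ *ᵥ ·) h1
    simpa [Matrix.mulVec_mulVec, hK] using this
  refine ⟨hNpd.inv, ?_⟩
  set N := Vᵀ * M * V with hNdef
  have hdet : IsUnit N.det := (Matrix.isUnit_iff_isUnit_det _).1 hNpd.isUnit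
  have hNi : (N⁻¹)ᵀ = N⁻¹ := by
    rw [← Matrix.conjTranspose_eq_transpose_of_trivial]
    exact hNpd.inv.isHermitian
  have hVMK : Vᵀ * M * K = 1 := by rw [hVK, hK]
  have hKMV : Kᵀ * M * V = 1 := by rw [Matrix.mul_assoc, ← hV, hK]
  -- Completing the square. The cross terms simplify because MV = K and KᵀK = 1; the left side is
  -- positive semidefinite along with M.
  have key : (K - V * N⁻¹)ᵀ * M * (K - V * N⁻¹) = Kᵀ * M * K - N⁻¹ := by
    have e1 : Kᵀ * M * (V * N⁻¹) = N⁻¹ := by rw [← Matrix.mul_assoc, hKMV, Matrix.one_mul]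
    have e2 : N⁻¹ * Vᵀ * M * K = N⁻¹ := by
      rw [Matrix.mul_assoc, Matrix.mul_assoc, ← Matrix.mul_assoc Vᵀ, hVMK, Matrix.mul_one]
    have e3 : N⁻¹ * Vᵀ * M * (V * N⁻¹) = N⁻¹ := by
      have : N⁻¹ * Vᵀ * M * (V * N⁻¹) = N⁻¹ * N * N⁻¹ := by
        rw [hNdef]
        simp only [Matrix.mul_assoc]
      rw [this, Matrix.nonsing_inv_mul _ hdet, Matrix.one_mul]
    rw [Matrix.transpose_sub, Matrix.transpose_mul, hNi, Matrix.sub_mul, Matrix.sub_mul,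
      Matrix.mul_sub, Matrix.mul_sub, e1, e2, e3]
    abel
  have hpsd : (Kᵀ * M * K - N⁻¹).PosSemidef := by
    rw [← key]
    simpa [Matrix.conjTranspose_eq_transpose_of_trivial] using
      hM.conjTranspose_mul_mul_same (K - V * N⁻¹)
  have := hpsd.trace_nonneg
  rw [Matrix.trace_sub] at this
  linarith

theorem trace_cfc_eq_sum {C : Matrix κ κ ℝ} (hC : C.IsHermitian) (g : ℝ → ℝ) :
    (cfc g C).trace = ∑ i, g (hC.eigenvalues i) := by
  rw [hC.cfc_eq, Matrix.IsHermitian.cfc, Unitary.conjStarAlgAut_apply, Matrix.trace_mul_comm,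
    ← mul_assoc]
  simp

/-- Among the positive definite matrices of bounded trace, a scalar matrix is best for
all of Kiefer's criteria. -/
theorem kiefer_le_kiefer_smul_one [Nonempty κ] {C : Matrix κ κ ℝ} (hC : C.PosDef) {c : ℝ}
    (hc : 0 < c) (htr : C.trace ≤ Fintype.card κ * c) {p : EReal} (hp : p < 1) :
    kiefer p C ≤ kiefer p (c • (1 : Matrix κ κ ℝ)) := by
  have hpos := hC.eigenvalues_pos
  have hsum : ∑ i, hC.isHermitian.eigenvalues i ≤ Fintype.card κ * c := by
    have := hC.isHermitian.trace_eq_sum_eigenvalues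
    simp only [RCLike.ofReal_real_eq_id, id] at this
    rw [← this]
    exact htr
  set ev := hC.isHermitian.eigenvalues with hev
  have hs : (0 : ℝ) < Fintype.card κ := by exact_mod_cast Fintype.card_pos
  have halg : c • (1 : Matrix κ κ ℝ) = algebraMap ℝ _ c := (Algebra.algebraMap_eq_smul_one c).symm
  have hmean : (∑ i, (1 / (Fintype.card κ : ℝ)) * ev i) ≤ c := by
    rw [← Finset.mul_sum, one_div, inv_mul_le_iff₀ hs]
    exact hsum
  have hw : ∑ i : κ, (1 / (Fintype.card κ : ℝ)) = 1 := by
    rw [Finset.sum_const, Finset.card_univ, nsmul_eq_mul, mul_one_div_cancel hs.ne']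
  have hmean0 : 0 < ∑ i, (1 / (Fintype.card κ : ℝ)) * ev i :=
    Finset.sum_pos (fun i _ => by have := hpos i; positivity) Finset.univ_nonempty
  unfold kiefer
  split_ifs with h1 h2
  · rw [halg, spectrum.scalar_eq, csInf_singleton,
      hC.isHermitian.spectrum_real_eq_range_eigenvalues]
    -- For p = -∞: the smallest eigenvalue is at most the mean.
    obtain ⟨i, -, hi⟩ : ∃ i ∈ Finset.univ, ev i ≤ c := by
      refine Finset.exists_le_of_sum_le Finset.univ_nonempty ?_
      simpa using hsum
    exact (csInf_le (Set.finite_range _).bddBelow ⟨i, rfl⟩).trans hi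
  · have hdet : C.det = ∏ i, ev i := by
      simpa using hC.isHermitian.det_eq_prod_eigenvalues
    rw [Matrix.det_smul, Matrix.det_one, mul_one, ← Real.rpow_natCast, ← Real.rpow_mul hc.le,
      mul_one_div_cancel hs.ne', Real.rpow_one, hdet,
      ← Real.finsetProd_rpow _ _ fun i _ => (hpos i).le]
    exact (Real.geom_mean_le_arith_mean_weighted Finset.univ (fun _ => 1 / (Fintype.card κ : ℝ)) ev
      (fun i _ => by positivity) hw fun i _ => (hpos i).le).trans hmean
  · have hpb : p ≠ ⊤ := ne_top_of_lt hp
    lift p to ℝ using ⟨hpb, h1⟩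
    simp only [EReal.toReal_coe]
    have hp0 : p ≠ 0 := by exact_mod_cast h2
    have hp1 : p < 1 := by exact_mod_cast hp
    rw [halg, cfc_algebraMap, trace_cfc_eq_sum hC.isHermitian, ← hev,
      Algebra.algebraMap_eq_smul_one, Matrix.trace_smul, Matrix.trace_one, smul_eq_mul,
      mul_comm (c ^ p)]
    have hS : 0 < ∑ i, ev i ^ p :=
      Finset.sum_pos (fun i _ => Real.rpow_pos_of_pos (hpos i) _) Finset.univ_nonempty
    have hT : ∑ i, ev i ^ p = Fintype.card κ * ∑ i, (1 / (Fintype.card κ : ℝ)) * ev i ^ p := by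
      rw [← Finset.mul_sum, ← mul_assoc, mul_one_div_cancel hs.ne', one_mul]
    rcases lt_or_gt_of_ne hp0 with hneg | hpos'
    -- Jensen for a negative exponent, from AM–GM used twice: the geometric mean commutes with
    -- powers, so (AM ev)^p ≤ (GM ev)^p = GM(ev^p) ≤ AM(ev^p). The outer exponent 1/p < 0 then
    -- reverses the inequality.
    · have hj : (∑ i, (1 / (Fintype.card κ : ℝ)) * ev i) ^ p ≤
          ∑ i, (1 / (Fintype.card κ : ℝ)) * ev i ^ p := by
        have h3 := Real.geom_mean_le_arith_mean_weighted Finset.univ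
          (fun _ => 1 / (Fintype.card κ : ℝ)) ev (fun i _ => by positivity) hw
          fun i _ => (hpos i).le
        have h4 := Real.geom_mean_le_arith_mean_weighted Finset.univ
          (fun _ => 1 / (Fintype.card κ : ℝ)) (fun i => ev i ^ p) (fun i _ => by positivity) hw
          fun i _ => Real.rpow_nonneg (hpos i).le _
        refine le_trans ?_ h4
        have hcomm : ∀ i, (ev i ^ p) ^ (1 / (Fintype.card κ : ℝ)) =
            (ev i ^ (1 / (Fintype.card κ : ℝ))) ^ p := fun i => by
          rw [← Real.rpow_mul (hpos i).le, mul_comm, Real.rpow_mul (hpos i).le]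
        rw [Finset.prod_congr rfl fun i _ => hcomm i,
          Real.finsetProd_rpow _ _ fun i _ => Real.rpow_nonneg (hpos i).le _]
        exact Real.rpow_le_rpow_of_nonpos
          (Finset.prod_pos fun i _ => Real.rpow_pos_of_pos (hpos i) _) h3 hneg.le
      refine Real.rpow_le_rpow_of_nonpos (by positivity) ?_ (one_div_neg.2 hneg).le
      rw [hT]
      exact mul_le_mul_of_nonneg_left
        ((Real.rpow_le_rpow_of_nonpos hmean0 hmean hneg.le).trans hj) hs.le
    · refine Real.rpow_le_rpow hS.le ?_ (by positivity)
      have hj := (Real.concaveOn_rpow hpos'.le hp1.le).le_map_sum (t := Finset.univ)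
        (w := fun _ : κ => 1 / (Fintype.card κ : ℝ)) (p := ev) (fun i _ => by positivity) hw
        fun i _ => (hpos i).le
      simp only [smul_eq_mul] at hj
      rw [hT]
      refine mul_le_mul_of_nonneg_left (hj.trans ?_) hs.le
      exact Real.rpow_le_rpow hmean0.le hmean hpos'.le

/-- With the threshold t = ev (s - 1), moving weight from the first s indices to later ones cannot
decrease the sum: (1_{i<s} - w i)(ev i - t) ≤ 0 for each i. Both weightings have total s, so the
terms in t cancel on summation. For s = 0 there is no threshold, but all weights vanish. -/
theorem sum_smallest_le_sum_mul {N s : ℕ} {ev : Fin N → ℝ} (hev : Monotone ev) {w : Fin N → ℝ}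
    (hw0 : ∀ i, 0 ≤ w i) (hw1 : ∀ i, w i ≤ 1) (hw : ∑ i, w i = s) (hs : s ≤ N) :
    ∑ i : Fin N with i.val < s, ev i ≤ ∑ i, w i * ev i := by
  rcases Nat.eq_zero_or_pos s with rfl | hs0
  · simp only [Nat.cast_zero] at hw
    have := (Finset.sum_eq_zero_iff_of_nonneg fun i _ => hw0 i).1 hw
    simp [this]
  · set t := ev ⟨s - 1, by omega⟩ with ht
    have hcard : (Finset.univ.filter fun i : Fin N => i.val < s).card = s := by
      rw [Fin.card_filter_val_lt, min_eq_right hs]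
    have h1 : ∀ i, (if i.val < s then ev i else 0) - (if i.val < s then t else 0) ≤
        w i * ev i - w i * t := by
      intro i
      split_ifs with hi
      · have : ev i ≤ t := hev (by rw [Fin.le_def]; simp; omega)
        nlinarith [hw1 i]
      · have : t ≤ ev i := hev (by rw [Fin.le_def]; simp; omega)
        nlinarith [hw0 i]
    have h2 := Finset.sum_le_sum fun i (_ : i ∈ Finset.univ) => h1 i
    rw [Finset.sum_sub_distrib, Finset.sum_sub_distrib, ← Finset.sum_filter, ← Finset.sum_filter,
      Finset.sum_const, hcard, ← Finset.sum_mul, hw, nsmul_eq_mul] at h2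
    linarith

/-- Ky Fan's inequality: the sum of the `s` smallest eigenvalues is at most the sum of any `s`
diagonal entries. -/
theorem phiE_le_sum_diag (f : ι → X → ℝ) (η : Measure X) (A : Finset ι) :
    phiE f A.card η ≤ ∑ a ∈ A, infoMatrix f η a a := by
  set hM := isHermitian_infoMatrix f η
  set U : Matrix ι ι ℝ := (hM.eigenvectorUnitary : Matrix ι ι ℝ) with hU
  have hUU : U * Uᵀ = 1 := by
    simpa [Matrix.star_eq_conjTranspose, Matrix.conjTranspose_eq_transpose_of_trivial] using
      Unitary.coe_mul_star_self hM.eigenvectorUnitary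
  have hUU' : Uᵀ * U = 1 := by
    simpa [Matrix.star_eq_conjTranspose, Matrix.conjTranspose_eq_transpose_of_trivial] using
      Unitary.coe_star_mul_self hM.eigenvectorUnitary
  have hrow : ∀ a, ∑ j, U a j ^ 2 = 1 := by
    intro a
    have := congrFun (congrFun hUU a) a
    simpa [Matrix.mul_apply, sq] using this
  have hcol : ∀ j, ∑ a, U a j ^ 2 = 1 := by
    intro j
    have := congrFun (congrFun hUU' j) j
    simpa [Matrix.mul_apply, sq] using this
  have hdiag : ∀ a, infoMatrix f η a a = ∑ j, U a j ^ 2 * hM.eigenvalues j := by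
    intro a
    have := congrFun (congrFun hM.spectral_theorem a) a
    rw [this, Unitary.conjStarAlgAut_apply, Matrix.mul_apply]
    refine Finset.sum_congr rfl fun j _ => ?_
    rw [Matrix.mul_diagonal]
    change U a j * hM.eigenvalues j * U a j = _
    ring
  -- `eigenvalues₀` is in decreasing order, hence the reversal.
  let e : Fin (Fintype.card ι) ≃ ι :=
    Fin.revPerm.trans (Fintype.equivOfCardEq (Fintype.card_fin _))
  have he : ∀ i, hM.eigenvalues (e i) = sortedEigenvalue f η i := by
    intro i
    simp [e, Matrix.IsHermitian.eigenvalues, sortedEigenvalue]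
  have hmono : Monotone (sortedEigenvalue f η) := fun i j hij =>
    hM.eigenvalues₀_antitone (Fin.rev_le_rev.2 hij)
  -- The squared entries of an orthogonal matrix are doubly stochastic: summed over the rows in A
  -- they give weights in [0, 1] (columns) of total |A| (rows).
  have h := sum_smallest_le_sum_mul (s := A.card) hmono
    (w := fun i => ∑ a ∈ A, U a (e i) ^ 2)
    (fun i => Finset.sum_nonneg fun a _ => sq_nonneg _)
    (fun i => (Finset.sum_le_univ_sum_of_nonneg fun a => sq_nonneg _).trans (hcol _).le)
    (by
      have hre : ∀ a, ∑ i, U a (e i) ^ 2 = 1 := fun a =>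
        (Equiv.sum_comp e fun j => U a j ^ 2).trans (hrow a)
      rw [Finset.sum_comm, Finset.sum_congr rfl fun a _ => hre a]
      simp) (Finset.card_le_univ A)
  refine h.trans (le_of_eq ?_)
  simp_rw [← he]
  rw [Equiv.sum_comp e fun j => (∑ a ∈ A, U a j ^ 2) * hM.eigenvalues j]
  simp_rw [hdiag, Finset.sum_mul]
  exact Finset.sum_comm

theorem phiE_of_infoMatrix_eq_smul_one {f : ι → X → ℝ} {η : Measure X} {c : ℝ}
    (h : infoMatrix f η = c • (1 : Matrix ι ι ℝ)) {s : ℕ} (hs : s ≤ Fintype.card ι) :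
    phiE f s η = s * c := by
  have hev : ∀ j, (isHermitian_infoMatrix f η).eigenvalues j = c := by
    intro j
    have : Nonempty ι := ⟨j⟩
    simpa [h, ← Algebra.algebraMap_eq_smul_one, spectrum.scalar_eq] using
      (isHermitian_infoMatrix f η).eigenvalues_mem_spectrum_real j
  have hs' : ∀ i, sortedEigenvalue f η i = c := by
    intro i
    have := hev (Fintype.equivOfCardEq (Fintype.card_fin _) i.rev)
    simpa [Matrix.IsHermitian.eigenvalues, sortedEigenvalue] using this
  unfold phiE
  simp [hs', Fin.card_filter_val_lt, hs]

/-- The abstract optimality result: a design with information matrix `c • 1` is optimal if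
the design-wise sum of the squares of the selected regression functions is constant. -/
theorem isPhiOptimal_of_trace_le [Nonempty κ] {f : ι → X → ℝ} {S : Set X} {K : Matrix ι κ ℝ}
    {ξ : Measure X} {c : ℝ} (hc : 0 < c) (hξ : IsDesign S ξ)
    (hM : infoMatrix f ξ = c • (1 : Matrix ι ι ℝ)) (hK : Kᵀ * K = 1)
    (hint : ∀ η, IsDesign S η → ∀ a b, Integrable (fun x => f a x * f b x) η)
    (htr : ∀ η, IsDesign S η → (Kᵀ * infoMatrix f η * K).trace ≤ Fintype.card κ * c)
    {p : EReal} (hp : p < 1) : IsPhiOptimal f S K p ξ := by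
  have hest : Estimable f K ξ := by
    rintro _ ⟨v, rfl⟩
    exact ⟨c⁻¹ • K *ᵥ v, by simp [hM, smul_smul, hc.ne']⟩
  have hC : cMatrix f K ξ = c • (1 : Matrix κ κ ℝ) := by
    -- The scalar inverse replaces the Moore–Penrose one, which avoids computing the latter.
    rw [cMatrix_eq_of_isGenInv f K ξ hest (c⁻¹ • 1) (by simp [hM, smul_smul, hc.ne'])]
    rw [Matrix.mul_smul, Matrix.mul_one, Matrix.smul_mul, hK]
    refine Matrix.inv_eq_left_inv ?_
    simp [smul_smul, hc.ne']
  refine ⟨hξ, hest, fun η hη hKη => ?_⟩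
  obtain ⟨h1, h2⟩ := cMatrix_posDef_and_trace_le (hint η hη) hK hKη
  rw [hC]
  exact kiefer_le_kiefer_smul_one h1 hc (h2.trans (htr η hη)) hp

end

end OptDesign

/-! ### Gegenbauer polynomials: derivative, differential equation, lowering relation. -/

namespace Hyperspherical

open MeasureTheory Polynomial

/-- The coefficient of `(2x)^(k-2j)` in the Gegenbauer polynomial `C_k^α`. -/
noncomputable def gegenbauerCoeff (k : ℕ) (α : ℝ) (j : ℕ) : ℝ :=
  (-1) ^ j * (ascPochhammer ℝ (k - j)).eval α / ((j.factorial : ℝ) * ((k - 2 * j).factorial : ℝ))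

theorem gegenbauer_eq (k : ℕ) (α : ℝ) : gegenbauer k α =
    ∑ j ∈ Finset.range (k / 2 + 1),
      Polynomial.C (gegenbauerCoeff k α j) * (2 * Polynomial.X) ^ (k - 2 * j) := rfl

@[simp]
theorem gegenbauer_zero (α : ℝ) : gegenbauer 0 α = 1 := by
  simp [gegenbauer]

theorem derivative_two_mul_X_pow (r : ℕ) :
    derivative ((2 * X : ℝ[X]) ^ r) = 2 * (r : ℝ[X]) * (2 * X) ^ (r - 1) := by
  rw [derivative_pow]
  simp
  ring

theorem derivative_gegenbauer_succ (k : ℕ) (α : ℝ) :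
    derivative (gegenbauer (k + 1) α) = C (2 * α) * gegenbauer k (α + 1) := by
  have hterm : ∀ j ∈ Finset.range (k / 2 + 1),
      derivative (C (gegenbauerCoeff (k + 1) α j) * (2 * X) ^ (k + 1 - 2 * j)) =
        C (2 * α) * (C (gegenbauerCoeff k (α + 1) j) * (2 * X) ^ (k - 2 * j)) := by
    intro j hj
    rw [Finset.mem_range] at hj
    obtain ⟨r, rfl⟩ : ∃ r, k = r + 2 * j := ⟨k - 2 * j, by omega⟩
    have e1 : r + 2 * j + 1 - 2 * j = r + 1 := by omega
    have e2 : r + 2 * j - 2 * j = r := by omega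
    have e3 : r + 2 * j + 1 - j = (r + j) + 1 := by omega
    have e4 : r + 2 * j - j = r + j := by omega
    have hc : gegenbauerCoeff (r + 2 * j + 1) α j * (r + 1) =
        α * gegenbauerCoeff (r + 2 * j) (α + 1) j := by
      simp only [gegenbauerCoeff, e1, e2, e3, e4, ascPochhammer_succ_left, Nat.factorial_succ]
      have : (r.factorial : ℝ) ≠ 0 := by positivity
      have : (j.factorial : ℝ) ≠ 0 := by positivity
      simp
      field_simp
    rw [derivative_C_mul, derivative_two_mul_X_pow, e1, e2, Nat.add_sub_cancel]
    have hc' := congrArg (C : ℝ → ℝ[X]) hc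
    simp only [C_mul, C_add, C_1] at hc'
    have h2 : (C 2 : ℝ[X]) = 2 := rfl
    have hr : (C (r : ℝ) : ℝ[X]) = (r : ℝ[X]) := by simp
    rw [hr] at hc'
    push_cast
    rw [C_mul, h2]
    linear_combination (2 * (2 * X) ^ r) * hc'
  rw [gegenbauer_eq, gegenbauer_eq, derivative_sum, Finset.mul_sum, ← Finset.sum_congr rfl hterm]
  rcases Nat.even_or_odd' k with ⟨l, rfl | rfl⟩
  · rw [show (2 * l + 1) / 2 = 2 * l / 2 by omega]
  -- For odd k the left side has one more term, a constant, which the derivative kills.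
  · rw [show (2 * l + 1 + 1) / 2 + 1 = ((2 * l + 1) / 2 + 1) + 1 by omega,
      Finset.sum_range_succ]
    rw [show 2 * l + 1 + 1 - 2 * ((2 * l + 1) / 2 + 1) = 0 by omega]
    simp

theorem gegenbauer_ode (k : ℕ) (α : ℝ) :
    (1 - X ^ 2) * derivative (derivative (gegenbauer k α)) -
      C (2 * α + 1) * X * derivative (gegenbauer k α) +
      C (k * (k + 2 * α)) * gegenbauer k α = 0 := by
  -- The operator maps the j-th monomial to a multiple of itself, with factor k(k+2α) - r(r+2α) =
  -- 4j(k-j+α) for r = k - 2j, and a multiple of the next monomial, which the coefficient recurrence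
  -- turns into -W (j + 1). The sum telescopes; W 0 vanishes through the factor j, the other end
  -- through the cutoff.
  set W : ℕ → ℝ[X] := fun j => if j ≤ k / 2 then
    C (4 * j * (k - j + α) * gegenbauerCoeff k α j) * (2 * X) ^ (k - 2 * j) else 0 with hW
  have hterm : ∀ j ∈ Finset.range (k / 2 + 1),
      (1 - X ^ 2) * derivative (derivative
          (C (gegenbauerCoeff k α j) * (2 * X) ^ (k - 2 * j))) -
        C (2 * α + 1) * X * derivative (C (gegenbauerCoeff k α j) * (2 * X) ^ (k - 2 * j)) +
        C (k * (k + 2 * α)) * (C (gegenbauerCoeff k α j) * (2 * X) ^ (k - 2 * j)) =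
      W j - W (j + 1) := by
    intro j hj
    rw [Finset.mem_range] at hj
    obtain ⟨r, rfl⟩ : ∃ r, k = r + 2 * j := ⟨k - 2 * j, by omega⟩
    have e2 : r + 2 * j - 2 * j = r := by omega
    have h1 : j ≤ (r + 2 * j) / 2 := by omega
    simp only [hW, if_pos h1, e2]
    have h2 : (C 2 : ℝ[X]) = 2 := rfl
    have h4 : (C 4 : ℝ[X]) = 4 := rfl
    have hd : ∀ r : ℕ, derivative (derivative ((2 * X : ℝ[X]) ^ r)) =
        4 * (r : ℝ[X]) * ((r - 1 : ℕ) : ℝ[X]) * (2 * X) ^ (r - 2) := by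
      intro r
      rw [derivative_two_mul_X_pow, show (2 * (r : ℝ[X])) = C (2 * (r : ℝ)) by simp [h2],
        derivative_C_mul, derivative_two_mul_X_pow, Nat.sub_sub]
      simp only [C_mul, h2, map_natCast]
      ring
    rw [derivative_C_mul, derivative_C_mul, hd, derivative_two_mul_X_pow]
    match r with
    | 0 =>
      rw [if_neg (by omega)]
      simp only [C_mul, C_add, C_sub, C_1, h2, h4, map_natCast]
      push_cast
      ring
    | 1 =>
      rw [if_neg (by omega)]
      simp only [C_mul, C_add, C_sub, C_1, h2, h4, map_natCast]
      push_cast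
      ring
    | r + 2 =>
      rw [if_pos (by omega)]
      have hc : 4 * ((j : ℝ) + 1) * (r + 1 + j + α) * gegenbauerCoeff (r + 2 + 2 * j) α (j + 1) =
          - 4 * (r + 2) * (r + 1) * gegenbauerCoeff (r + 2 + 2 * j) α j := by
        have e1 : r + 2 + 2 * j - 2 * j = r + 2 := by omega
        have e2 : r + 2 + 2 * j - 2 * (j + 1) = r := by omega
        have e3 : r + 2 + 2 * j - j = (r + 1 + j) + 1 := by omega
        have e4 : r + 2 + 2 * j - (j + 1) = r + 1 + j := by omega
        simp only [gegenbauerCoeff, e1, e2, e3, e4, ascPochhammer_succ_eval, Nat.factorial_succ]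
        have : (r.factorial : ℝ) ≠ 0 := by positivity
        have : (j.factorial : ℝ) ≠ 0 := by positivity
        push_cast
        field_simp
        ring
      rw [show r + 2 + 2 * j - 2 * (j + 1) = r by omega, show r + 2 - 1 = r + 1 by omega,
        Nat.add_sub_cancel]
      have hc' : (4 * ((j + 1 : ℕ) : ℝ) * (((r + 2 + 2 * j : ℕ) : ℝ) - ((j + 1 : ℕ) : ℝ) + α) *
          gegenbauerCoeff (r + 2 + 2 * j) α (j + 1)) =
          - 4 * (r + 2) * (r + 1) * gegenbauerCoeff (r + 2 + 2 * j) α j := by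
        rw [← hc]
        push_cast
        ring
      rw [hc']
      generalize gegenbauerCoeff (r + 2 + 2 * j) α j = c
      simp only [C_mul, C_add, C_sub, C_neg, C_1, h2, h4, Nat.cast_add, Nat.cast_mul, map_natCast,
        Nat.cast_ofNat, Nat.cast_one]
      ring
  rw [gegenbauer_eq, derivative_sum, derivative_sum, Finset.mul_sum, Finset.mul_sum,
    Finset.mul_sum, ← Finset.sum_sub_distrib, ← Finset.sum_add_distrib,
    Finset.sum_congr rfl hterm, Finset.sum_range_sub']
  simp [hW]

/-- The Gegenbauer polynomial with half-integral parameter `N / 2`, orthogonal for the weight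
`sin ^ N` on `[0, π]`. -/
noncomputable def ultraspherical (N k : ℕ) : ℝ[X] := gegenbauer k ((N : ℝ) / 2)

theorem derivative_ultraspherical_zero (N : ℕ) : derivative (ultraspherical N 0) = 0 := by
  simp [ultraspherical]

theorem derivative_ultraspherical_succ (N k : ℕ) :
    derivative (ultraspherical N (k + 1)) = C (N : ℝ) * ultraspherical (N + 2) k := by
  unfold ultraspherical
  rw [derivative_gegenbauer_succ]
  congr 2
  · ring
  · push_cast
    ring

theorem ultraspherical_ode (N k : ℕ) :
    (1 - X ^ 2) * derivative (derivative (ultraspherical N k)) -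
      C ((N : ℝ) + 1) * X * derivative (ultraspherical N k) =
      - (C ((k : ℝ) * (k + N)) * ultraspherical N k) := by
  have h := gegenbauer_ode k ((N : ℝ) / 2)
  rw [mul_div_cancel₀ _ (two_ne_zero' ℝ)] at h
  exact eq_neg_of_add_eq_zero_left h

/-- This is the differential equation in degree k + 1 after substituting the derivative formula; the
common factor N is cancelled, which is why N ≠ 0. -/
theorem ultraspherical_lowering {N : ℕ} (hN : N ≠ 0) (k : ℕ) :
    (1 - X ^ 2) * derivative (ultraspherical (N + 2) k) =
      C ((N : ℝ) + 1) * X * ultraspherical (N + 2) k -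
        C (((k : ℝ) + 1) * (k + 1 + N) / N) * ultraspherical N (k + 1) := by
  have hN' : (N : ℝ) ≠ 0 := by exact_mod_cast hN
  have h := ultraspherical_ode N (k + 1)
  rw [derivative_ultraspherical_succ, derivative_C_mul] at h
  have hc : (C (((k : ℝ) + 1) * (k + 1 + N)) : ℝ[X]) =
      C (N : ℝ) * C (((k : ℝ) + 1) * (k + 1 + N) / N) := by
    rw [← C_mul]
    congr 1
    field_simp
  push_cast at h
  rw [hc] at h
  refine mul_left_cancel₀ (C_ne_zero.2 hN') ?_
  linear_combination h

/-! ### Orthogonality and norms for the weight sin^N. -/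

/-- The integral of `p (cos t) sin t ^ N` over `[0, π]`. -/
noncomputable def cosIntegral (N : ℕ) (p : ℝ[X]) : ℝ :=
  ∫ t in (0 : ℝ)..Real.pi, p.eval (Real.cos t) * Real.sin t ^ N

theorem cosIntegral_C_mul (N : ℕ) (c : ℝ) (p : ℝ[X]) :
    cosIntegral N (C c * p) = c * cosIntegral N p := by
  simp [cosIntegral, mul_assoc]

/-- Integration by parts. -/
theorem cosIntegral_jacobi_mul (N : ℕ) (p q : ℝ[X]) :
    cosIntegral N (((1 - X ^ 2) * derivative (derivative p) -
      C ((N : ℝ) + 1) * X * derivative p) * q) =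
      - cosIntegral (N + 2) (derivative p * derivative q) := by
  -- The differential operator is in Sturm–Liouville form: the primitive is p'q(cos t) sin^(N+1) t,
  -- and its boundary values vanish since N + 1 > 0.
  have hderiv : ∀ t : ℝ, HasDerivAt
      (fun t => (derivative p * q).eval (Real.cos t) * Real.sin t ^ (N + 1))
      (- ((((1 - X ^ 2) * derivative (derivative p) - C ((N : ℝ) + 1) * X * derivative p) * q).eval
        (Real.cos t) * Real.sin t ^ N + (derivative p * derivative q).eval (Real.cos t) *
          Real.sin t ^ (N + 2))) t := by
    intro t
    have h1 := ((derivative p * q).hasDerivAt (Real.cos t)).comp t (Real.hasDerivAt_cos t)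
    have h2 := (Real.hasDerivAt_sin t).pow (N + 1)
    refine (h1.mul h2).congr_deriv ?_
    have hs : Real.sin t ^ 2 = 1 - Real.cos t ^ 2 := Real.sin_sq t
    simp only [derivative_mul, eval_add, eval_mul, eval_sub, eval_one, eval_pow, eval_X, eval_C,
      Function.comp_apply, Nat.add_sub_cancel, Pi.pow_apply]
    rw [← hs]
    push_cast
    ring
  have hc : ∀ (r : ℝ[X]) (M : ℕ),
      Continuous fun t : ℝ => r.eval (Real.cos t) * Real.sin t ^ M := fun r M => by fun_prop
  have h := intervalIntegral.integral_eq_sub_of_hasDerivAt (a := 0) (b := Real.pi)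
    (fun t _ => hderiv t) (((hc _ _).add (hc _ _)).neg.intervalIntegrable _ _)
  rw [intervalIntegral.integral_neg, intervalIntegral.integral_add
    ((hc _ _).intervalIntegrable _ _) ((hc _ _).intervalIntegrable _ _)] at h
  simp only [Real.sin_pi, Real.sin_zero, ne_eq, Nat.succ_ne_zero, not_false_eq_true, zero_pow,
    mul_zero, sub_zero] at h
  unfold cosIntegral
  linarith

theorem cosIntegral_ultraspherical_mul (N k : ℕ) (q : ℝ[X]) :
    (k : ℝ) * (k + N) * cosIntegral N (ultraspherical N k * q) =
      cosIntegral (N + 2) (derivative (ultraspherical N k) * derivative q) := by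
  have h := cosIntegral_jacobi_mul N (ultraspherical N k) q
  rw [ultraspherical_ode, ← neg_mul, ← C_neg, mul_assoc, cosIntegral_C_mul] at h
  linarith

/-- Integration by parts is symmetric in the two polynomials, while the eigenvalues differ by (l -
k)(l + k + N), nonzero even for N = 0. -/
theorem cosIntegral_ultraspherical_orthogonal (N : ℕ) {k l : ℕ} (hkl : k ≠ l) :
    cosIntegral N (ultraspherical N k * ultraspherical N l) = 0 := by
  have h1 := cosIntegral_ultraspherical_mul N k (ultraspherical N l)
  have h2 := cosIntegral_ultraspherical_mul N l (ultraspherical N k)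
  rw [mul_comm (ultraspherical N l), mul_comm (derivative (ultraspherical N l)), ← h1] at h2
  have h3 : ((l : ℝ) - k) * (l + k + N) *
      cosIntegral N (ultraspherical N k * ultraspherical N l) = 0 := by linear_combination h2
  have h4 : (l : ℝ) - k ≠ 0 := sub_ne_zero.2 (by exact_mod_cast hkl.symm)
  have h5 : (l : ℝ) + k + N ≠ 0 := by
    have : l + k + N ≠ 0 := by omega
    exact_mod_cast this
  exact (mul_eq_zero.1 h3).resolve_left (mul_ne_zero h4 h5)

/-- Trades one degree for two powers of sin, so that the norms reduce to integrals of powers of sin.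
-/
theorem cosIntegral_sq_succ (N k : ℕ) :
    ((k : ℝ) + 1) * (k + 1 + N) * cosIntegral N (ultraspherical N (k + 1) ^ 2) =
      (N : ℝ) ^ 2 * cosIntegral (N + 2) (ultraspherical (N + 2) k ^ 2) := by
  have h := cosIntegral_ultraspherical_mul N (k + 1) (ultraspherical N (k + 1))
  rw [derivative_ultraspherical_succ, show C (N : ℝ) * ultraspherical (N + 2) k *
    (C (N : ℝ) * ultraspherical (N + 2) k) = C ((N : ℝ) ^ 2) * ultraspherical (N + 2) k ^ 2 by
      rw [C_pow]; ring, cosIntegral_C_mul, ← sq] at h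
  push_cast at h
  exact h

theorem integral_sin_pow_two_step (N : ℕ) : (∫ t in (0 : ℝ)..Real.pi, Real.sin t ^ (N + 2)) =
    (N + 1) / (N + 2) * ∫ t in (0 : ℝ)..Real.pi, Real.sin t ^ N := by
  rw [integral_sin_pow]
  simp

theorem integral_sin_pow_eq_Gamma (N : ℕ) : (∫ t in (0 : ℝ)..Real.pi, Real.sin t ^ N) =
    √Real.pi * Real.Gamma (((N : ℝ) + 1) / 2) / Real.Gamma ((N : ℝ) / 2 + 1) := by
  have hpi : √Real.pi ≠ 0 := by positivity
  induction N using Nat.twoStepInduction with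
  | zero =>
    have hG := Real.Gamma_one_half_eq
    rw [one_div] at hG
    simp [hG, Real.mul_self_sqrt Real.pi_pos.le]
  | one =>
    have h : Real.Gamma ((1 : ℝ) / 2 + 1) = 1 / 2 * √Real.pi := by
      rw [Real.Gamma_add_one (by norm_num), Real.Gamma_one_half_eq]
    simp only [pow_one, integral_sin, Nat.cast_one, h, Real.cos_zero, Real.cos_pi]
    norm_num
    field_simp
  | more N ih _ =>
    rw [integral_sin_pow_two_step, ih]
    have h1 : Real.Gamma ((((N + 2 : ℕ) : ℝ) + 1) / 2) =
        ((N : ℝ) + 1) / 2 * Real.Gamma (((N : ℝ) + 1) / 2) := by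
      rw [← Real.Gamma_add_one (by positivity)]
      congr 1
      push_cast
      ring
    have h2 : Real.Gamma (((N + 2 : ℕ) : ℝ) / 2 + 1) =
        ((N : ℝ) / 2 + 1) * Real.Gamma ((N : ℝ) / 2 + 1) := by
      rw [← Real.Gamma_add_one (by positivity)]
      congr 1
      push_cast
      ring
    have h3 : Real.Gamma ((N : ℝ) / 2 + 1) ≠ 0 := (Real.Gamma_pos_of_pos (by positivity)).ne'
    rw [h1, h2]
    field_simp

/-- Written in the shape of `cosIntegral_sq` at degree 0, where it starts the induction. -/
theorem integral_sin_pow_succ_eq_factorial (N : ℕ) :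
    (∫ t in (0 : ℝ)..Real.pi, Real.sin t ^ (N + 1)) =
      2 * Real.pi * N.factorial /
        (2 ^ (N + 1) * (((N : ℝ) + 1) / 2) * Real.Gamma (((N : ℝ) + 1) / 2) ^ 2) := by
  induction N using Nat.twoStepInduction with
  | zero =>
    have hG := Real.Gamma_one_half_eq
    have hs : (√Real.pi) ^ 2 = Real.pi := Real.sq_sqrt Real.pi_pos.le
    simp only [CharP.cast_eq_zero, zero_add, pow_one, integral_sin, Real.cos_zero, Real.cos_pi, hG,
      hs, Nat.factorial_zero, Nat.cast_one]
    field_simp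
    norm_num
  | one =>
    simp
    field_simp
  | more N ih _ =>
    rw [show N + 2 + 1 = N + 1 + 2 by ring, integral_sin_pow_two_step, ih]
    have h1 : Real.Gamma ((((N + 2 : ℕ) : ℝ) + 1) / 2) =
        ((N : ℝ) + 1) / 2 * Real.Gamma (((N : ℝ) + 1) / 2) := by
      rw [← Real.Gamma_add_one (by positivity)]
      congr 1
      push_cast
      ring
    have h3 : Real.Gamma (((N : ℝ) + 1) / 2) ≠ 0 := (Real.Gamma_pos_of_pos (by positivity)).ne'
    rw [h1, Nat.factorial_succ, Nat.factorial_succ]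
    push_cast
    field_simp
    ring

/-- The square of the norm of a Gegenbauer polynomial. -/
theorem cosIntegral_sq (N k : ℕ) : cosIntegral (N + 1) (ultraspherical (N + 1) k ^ 2) =
    2 * Real.pi * (k + N).factorial / (2 ^ (N + 1) * k.factorial * (k + ((N : ℝ) + 1) / 2) *
      Real.Gamma (((N : ℝ) + 1) / 2) ^ 2) := by
  induction k generalizing N with
  | zero =>
    have : ultraspherical (N + 1) 0 = 1 := by simp [ultraspherical]
    simp only [this, cosIntegral, one_pow, eval_one, one_mul]
    rw [integral_sin_pow_succ_eq_factorial]
    simp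
  | succ k ih =>
    have h := cosIntegral_sq_succ (N + 1) k
    rw [show N + 1 + 2 = (N + 2) + 1 by ring, ih (N + 2)] at h
    have hne : ((k : ℝ) + 1) * (k + 1 + ((N + 1 : ℕ) : ℝ)) ≠ 0 := by positivity
    refine mul_left_cancel₀ hne (h.trans ?_)
    have h1 : Real.Gamma ((((N + 2 : ℕ) : ℝ) + 1) / 2) =
        ((N : ℝ) + 1) / 2 * Real.Gamma (((N : ℝ) + 1) / 2) := by
      rw [← Real.Gamma_add_one (by positivity)]
      congr 1
      push_cast
      ring
    have h3 : Real.Gamma (((N : ℝ) + 1) / 2) ≠ 0 := (Real.Gamma_pos_of_pos (by positivity)).ne'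
    rw [h1, show k + (N + 2) = (k + 1 + N) + 1 by ring, Nat.factorial_succ (k + 1 + N),
      Nat.factorial_succ k]
    have h4 : (k.factorial : ℝ) ≠ 0 := by positivity
    push_cast
    field_simp
    ring

theorem cosIntegral_sq_pos (N k : ℕ) :
    0 < cosIntegral (N + 1) (ultraspherical (N + 1) k ^ 2) := by
  have h3 : 0 < Real.Gamma (((N : ℝ) + 1) / 2) := Real.Gamma_pos_of_pos (by positivity)
  rw [cosIntegral_sq]
  positivity

/-! ### Constancy of a weighted sum of squares of Gegenbauer polynomials. -/

/-- The one-dimensional step of the addition theorem on the diagonal. -/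
theorem exists_sum_ultraspherical_sq_eq (N a : ℕ) (t w : ℕ → ℝ) (hw0 : w 0 = 1)
    (hw : ∀ b : ℕ, (2 * (b : ℝ) + N) * w b = b + N)
    (ht : ∀ b < a, t b * w b = t (b + 1) * (1 - w (b + 1))) :
    ∃ c : ℝ, ∀ x : ℝ, ∑ b ∈ Finset.range (a + 1),
      t b / cosIntegral (N + 1 + 2 * b) (ultraspherical (N + 1 + 2 * b) (a - b) ^ 2) *
        ((ultraspherical (N + 1 + 2 * b) (a - b)).eval x ^ 2 * (1 - x ^ 2) ^ b) = c := by
  set h : ℕ → ℝ := fun b =>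
    cosIntegral (N + 1 + 2 * b) (ultraspherical (N + 1 + 2 * b) (a - b) ^ 2) with hh
  set U : ℕ → ℝ[X] := fun b => ultraspherical (N + 1 + 2 * b) (a - b) with hU
  set P : ℝ[X] := ∑ b ∈ Finset.range (a + 1), C (t b / h b) * (U b ^ 2 * (1 - X ^ 2) ^ b) with hP
  have hpos : ∀ b, 0 < h b := fun b => by
    rw [hh]
    simp only
    rw [show N + 1 + 2 * b = N + 2 * b + 1 by ring]
    exact cosIntegral_sq_pos _ _
  have hrec : ∀ b < a, ((a : ℝ) - b) * (a + b + N + 1) * h b = (N + 1 + 2 * b) ^ 2 * h (b + 1) := by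
    intro b hb
    obtain ⟨k, rfl⟩ : ∃ k, a = b + 1 + k := ⟨a - b - 1, by omega⟩
    have := cosIntegral_sq_succ (N + 1 + 2 * b) k
    simp only [hh]
    rw [show b + 1 + k - b = k + 1 by omega, show b + 1 + k - (b + 1) = k by omega,
      show N + 1 + 2 * (b + 1) = N + 1 + 2 * b + 2 by ring]
    push_cast at this ⊢
    rw [← this]
    ring
  have hraise : ∀ b < a, derivative (U b) = C ((N : ℝ) + 1 + 2 * b) * U (b + 1) := by
    intro b hb
    obtain ⟨k, rfl⟩ : ∃ k, a = b + 1 + k := ⟨a - b - 1, by omega⟩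
    simp only [hU]
    rw [show b + 1 + k - b = k + 1 by omega, show b + 1 + k - (b + 1) = k by omega,
      derivative_ultraspherical_succ, show N + 1 + 2 * (b + 1) = N + 1 + 2 * b + 2 by ring]
    push_cast
    rfl
  have hlast : derivative (U a) = 0 := by
    simp only [hU, Nat.sub_self, derivative_ultraspherical_zero]
  have hlower : ∀ b < a, (1 - X ^ 2) * derivative (U (b + 1)) =
      C ((N : ℝ) + 2 + 2 * b) * X * U (b + 1) -
        C (((a : ℝ) - b) * (a + b + N + 1) / (N + 1 + 2 * b)) * U b := by
    intro b hb
    obtain ⟨k, rfl⟩ : ∃ k, a = b + 1 + k := ⟨a - b - 1, by omega⟩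
    have := ultraspherical_lowering (N := N + 1 + 2 * b) (by omega) k
    simp only [hU]
    rw [show b + 1 + k - b = k + 1 by omega, show b + 1 + k - (b + 1) = k by omega,
      show N + 1 + 2 * (b + 1) = N + 1 + 2 * b + 2 by ring, this]
    have e1 : ((N + 1 + 2 * b : ℕ) : ℝ) = N + 1 + 2 * b := by push_cast; ring
    have e2 : ((b + 1 + k : ℕ) : ℝ) = b + 1 + k := by push_cast; ring
    rw [e1, e2, show (N : ℝ) + 1 + 2 * b + 1 = N + 2 + 2 * b by ring,
      show ((b : ℝ) + 1 + k - b) * (b + 1 + k + b + N + 1) = (k + 1) * (k + 1 + (N + 1 + 2 * b)) by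
        ring]
  -- Y b is the exchange term between the summands b - 1 and b; the condition makes it vanish at
  -- both ends, 0 and a + 1.
  set Y : ℕ → ℝ → ℝ := fun b x => if 0 < b ∧ b ≤ a then
    2 * (t b / h b) * (1 - w b) * (((a : ℝ) - (b - 1)) * (a + (b - 1) + N + 1) /
      (N + 1 + 2 * (b - 1))) * (1 - x ^ 2) ^ b * (U (b - 1)).eval x * (U b).eval x else 0 with hY
  have hYsucc : ∀ b < a, ∀ x, Y (b + 1) x =
      2 * (t b / h b) * w b * (N + 1 + 2 * b) * (1 - x ^ 2) ^ (b + 1) * (U b).eval x *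
        (U (b + 1)).eval x := by
    intro b hb x
    simp only [hY]
    rw [if_pos ⟨by omega, by omega⟩, Nat.add_sub_cancel]
    have h1 := hrec b hb
    have h2 := ht b hb
    have hb0 := (hpos b).ne'
    have hb1 := (hpos (b + 1)).ne'
    have h3 : (N : ℝ) + 1 + 2 * b ≠ 0 := by positivity
    push_cast
    have h4 : (t (b + 1) / h (b + 1)) * (1 - w (b + 1)) *
        (((a : ℝ) - b) * (a + b + N + 1) / (N + 1 + 2 * b)) =
        (t b / h b) * w b * (N + 1 + 2 * b) := by
      field_simp
      linear_combination (-(((a : ℝ) - b) * (a + b + N + 1) * h b)) * h2 + t b * w b * h1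
    rw [show ((b : ℝ) + 1 - 1) = b by ring]
    linear_combination (2 * (1 - x ^ 2) ^ (b + 1) * (U b).eval x * (U (b + 1)).eval x) * h4
  have hY0 : ∀ x, Y 0 x = 0 := fun x => by simp [hY]
  have hYlast : ∀ x, Y (a + 1) x = 0 := fun x => by simp [hY]
  have hUx : ∀ b ≤ a, ∀ x, 2 * (t b / h b) * w b * (1 - x ^ 2) ^ (b + 1) * (U b).eval x *
      (derivative (U b)).eval x = Y (b + 1) x := by
    intro b hb x
    rcases hb.lt_or_eq with hb | rfl
    · rw [hYsucc b hb, hraise b hb]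
      simp
      ring
    · rw [hYlast, hlast]
      simp
  -- The derivative of U_b is split in the proportion w b : 1 - w b. The first share is raised to
  -- U_(b+1) and gives Y (b + 1), by `ht`. The second is lowered to U_(b-1) and gives -Y b plus a
  -- multiple of x U_b², which cancels the derivative of (1 - x²)^b exactly when (2b + N)(1 - w b) =
  -- b, that is, by `hw`. At b = 0 there is nothing to lower to, hence `hw0`, which `hw` does not
  -- imply for N = 0.
  have hterm : ∀ b ∈ Finset.range (a + 1), ∀ x : ℝ, (1 - x ^ 2) *
      (derivative (C (t b / h b) * (U b ^ 2 * (1 - X ^ 2) ^ b))).eval x = Y (b + 1) x - Y b x := by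
    intro b hb x
    rw [Finset.mem_range] at hb
    have hx := hUx b (by omega) x
    rcases b with _ | b
    · rw [hY0, ← hx, hw0]
      simp [derivative_pow]
      ring
    · have hl := congrArg (eval x) (hlower b (by omega))
      simp only [eval_mul, eval_sub, eval_one, eval_pow, eval_X, eval_C] at hl
      have hw' := hw (b + 1)
      have hYb : Y (b + 1) x = 2 * (t (b + 1) / h (b + 1)) * (1 - w (b + 1)) *
          (((a : ℝ) - b) * (a + b + N + 1) / (N + 1 + 2 * b)) * (1 - x ^ 2) ^ (b + 1) *
            (U b).eval x * (U (b + 1)).eval x := by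
        simp only [hY]
        rw [if_pos ⟨by omega, by omega⟩, Nat.add_sub_cancel]
        push_cast
        rw [show ((b : ℝ) + 1 - 1) = b by ring]
      rw [← hx, hYb]
      simp only [derivative_mul, derivative_pow, derivative_C, derivative_sub, derivative_one,
        derivative_X, eval_mul, eval_add, eval_sub, eval_pow, eval_one, eval_X, eval_C, zero_mul,
        zero_add, eval_zero, Nat.add_sub_cancel, map_natCast, eval_natCast]
      generalize ((a : ℝ) - b) * (a + b + N + 1) / (N + 1 + 2 * b) = κ at hl ⊢
      generalize t (b + 1) / h (b + 1) = r
      push_cast at hw' ⊢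
      linear_combination (2 * r * (1 - x ^ 2) ^ (b + 1) * (U (b + 1)).eval x * (1 - w (b + 1))) * hl
        - (2 * r * (1 - x ^ 2) ^ (b + 1) * (U (b + 1)).eval x ^ 2 * x) * hw'
  have hP' : (1 - X ^ 2) * derivative P = 0 := by
    refine Polynomial.funext fun x => ?_
    rw [hP, derivative_sum, eval_mul, eval_finsetSum, Finset.mul_sum]
    have : eval x (1 - X ^ 2 : ℝ[X]) = 1 - x ^ 2 := by simp
    rw [this, Finset.sum_congr rfl fun b hb => hterm b hb x,
      Finset.sum_range_sub fun b => Y b x, hY0, hYlast]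
    simp
  have hX : (1 - X ^ 2 : ℝ[X]) ≠ 0 := by
    intro h0
    have := congrArg (eval 0) h0
    simp at this
  have hPc := eq_C_of_derivative_eq_zero ((mul_eq_zero.1 hP').resolve_left hX)
  refine ⟨P.coeff 0, fun x => ?_⟩
  have := congrArg (eval x) hPc
  rw [eval_C] at this
  rw [← this, hP, eval_finsetSum]
  simp [hU, hh]

/-! ### Normalised polar factors and the constants A and B. -/

/-- The squared norm of the polar factor with indices `b ≤ a` for the weight `sin ^ (j + 1)`. -/
noncomputable def polarNorm (j a b : ℕ) : ℝ :=
  cosIntegral (j + 1 + 2 * b) (ultraspherical (j + 1 + 2 * b) (a - b) ^ 2)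

theorem polarNorm_pos (j a b : ℕ) : 0 < polarNorm j a b := by
  unfold polarNorm
  rw [show j + 1 + 2 * b = j + 2 * b + 1 by ring]
  exact cosIntegral_sq_pos _ _

/-- The normalised polar factor of a hyperspherical harmonic. -/
noncomputable def polar (j a b : ℕ) (t : ℝ) : ℝ :=
  (√(polarNorm j a b))⁻¹ *
    ((ultraspherical (j + 1 + 2 * b) (a - b)).eval (Real.cos t) * Real.sin t ^ b)

@[fun_prop]
theorem continuous_polar (j a b : ℕ) : Continuous (polar j a b) := by
  unfold polar
  fun_prop

theorem polar_sq (j a b : ℕ) (t : ℝ) : polar j a b t ^ 2 = 1 / polarNorm j a b *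
    ((ultraspherical (j + 1 + 2 * b) (a - b)).eval (Real.cos t) ^ 2 *
      (1 - Real.cos t ^ 2) ^ b) := by
  rw [← Real.sin_sq, polar, mul_pow, inv_pow, Real.sq_sqrt (polarNorm_pos j a b).le]
  ring

theorem integral_polar_mul_polar (j : ℕ) {a a' b : ℕ} (ha : b ≤ a) (ha' : b ≤ a') :
    (∫ t in (0 : ℝ)..Real.pi, polar j a b t * polar j a' b t * Real.sin t ^ (j + 1)) =
      if a = a' then 1 else 0 := by
  have h : ∀ t, polar j a b t * polar j a' b t * Real.sin t ^ (j + 1) =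
      (√(polarNorm j a b))⁻¹ * (√(polarNorm j a' b))⁻¹ *
        ((ultraspherical (j + 1 + 2 * b) (a - b) * ultraspherical (j + 1 + 2 * b) (a' - b)).eval
          (Real.cos t) * Real.sin t ^ (j + 1 + 2 * b)) := by
    intro t
    simp only [polar, eval_mul]
    ring
  simp_rw [h]
  rw [intervalIntegral.integral_const_mul]
  change _ * cosIntegral _ _ = _
  split_ifs with haa
  · subst haa
    rw [← sq, ← sq, inv_pow, Real.sq_sqrt (polarNorm_pos j a b).le]
    exact inv_mul_cancel₀ (polarNorm_pos j a b).ne'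
  · rw [cosIntegral_ultraspherical_orthogonal _ (by omega), mul_zero]

theorem sum_polar_sq (N a : ℕ) (t w : ℕ → ℝ) (hw0 : w 0 = 1)
    (hw : ∀ b : ℕ, (2 * (b : ℝ) + N) * w b = b + N)
    (ht : ∀ b < a, t b * w b = t (b + 1) * (1 - w (b + 1))) (θ : ℝ) :
    ∑ b ∈ Finset.range (a + 1), t b * polar N a b θ ^ 2 =
      (∑ b ∈ Finset.range (a + 1), t b) / ∫ t in (0 : ℝ)..Real.pi, Real.sin t ^ (N + 1) := by
  obtain ⟨c, hc⟩ := exists_sum_ultraspherical_sq_eq N a t w hw0 hw ht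
  have hsum : ∀ θ, ∑ b ∈ Finset.range (a + 1), t b * polar N a b θ ^ 2 = c := by
    intro θ
    rw [← hc (Real.cos θ)]
    refine Finset.sum_congr rfl fun b _ => ?_
    rw [polar_sq, polarNorm]
    ring
  -- The constant is identified by integrating against the weight, for which each polar factor has
  -- norm 1.
  have hint : (∫ s in (0 : ℝ)..Real.pi, (∑ b ∈ Finset.range (a + 1), t b * polar N a b s ^ 2) *
      Real.sin s ^ (N + 1)) = ∑ b ∈ Finset.range (a + 1), t b := by
    simp_rw [Finset.sum_mul]
    rw [intervalIntegral.integral_finsetSum]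
    · refine Finset.sum_congr rfl fun b hb => ?_
      have hb' : b ≤ a := by
        rw [Finset.mem_range] at hb
        omega
      have h1 := integral_polar_mul_polar N hb' hb'
      rw [if_pos rfl] at h1
      simp_rw [sq, mul_assoc (t b)]
      rw [intervalIntegral.integral_const_mul, h1, mul_one]
    · intro b _
      exact Continuous.intervalIntegrable (by fun_prop) _ _
  simp_rw [hsum] at hint ⊢
  rw [intervalIntegral.integral_const_mul] at hint
  rw [← hint, mul_div_cancel_right₀ _ (integral_sin_pow_pos _).ne']

/-- Here m = i + j + 3 and i counts from 0. The exponent of 2 in `constA` is 2b + j - 1, a natural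
subtraction that j ≠ 0 keeps from truncating; the angle with j = 0 is normalised by B instead. -/
theorem constA_eq (i j : ℕ) (hj : j ≠ 0) {a b : ℕ} (hab : b ≤ a) :
    constA (i + j + 3) (i + 1) a b = (√(polarNorm j a b))⁻¹ := by
  rw [← Real.sqrt_inv, constA]
  congr 1
  obtain ⟨k, rfl⟩ := Nat.exists_eq_add_of_le hab
  obtain ⟨j, rfl⟩ := Nat.exists_eq_succ_of_ne_zero hj
  rw [polarNorm, show j.succ + 1 + 2 * b = (j.succ + 2 * b) + 1 by ring, cosIntegral_sq,
    show b + k - b = k by omega, inv_div,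
    show 2 * b + (i + j.succ + 3) - (i + 1) - 3 = 2 * b + j by omega,
    show b + k + b + (i + j.succ + 3) - (i + 1) - 2 = k + (j.succ + 2 * b) by omega]
  have hG : (b : ℝ) + (((i + j.succ + 3 : ℕ) : ℝ) - ((i + 1 : ℕ) : ℝ) - 1) / 2 =
      (((j.succ + 2 * b : ℕ) : ℝ) + 1) / 2 := by
    push_cast
    ring
  rw [hG]
  rw [Nat.succ_eq_add_one]
  push_cast
  field_simp
  ring

theorem Gamma_nat_add_half_sq (u : ℕ) : Real.Gamma ((u : ℝ) + 1 / 2) ^ 2 * (4 ^ u * u.factorial) ^ 2 =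
    ((2 * u).factorial : ℝ) ^ 2 * Real.pi := by
  induction u with
  | zero =>
    simp only [CharP.cast_eq_zero, zero_add, Real.Gamma_one_half_eq, Real.sq_sqrt Real.pi_pos.le]
    simp
  | succ u ih =>
    rw [show ((u + 1 : ℕ) : ℝ) + 1 / 2 = ((u : ℝ) + 1 / 2) + 1 by push_cast; ring,
      Real.Gamma_add_one (by positivity), show 2 * (u + 1) = 2 * u + 1 + 1 by ring,
      Nat.factorial_succ, Nat.factorial_succ, Nat.factorial_succ]
    push_cast
    linear_combination ((2 * (u : ℝ) + 1 + 1) * (2 * u + 1)) ^ 2 * ih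

/-- B and the Legendre prefactor together normalise the last polar factor up to 1/√π, which goes to
`azimuth` along with the sign (-1)^u. -/
theorem constB_mul_eq {l u : ℕ} (hul : u ≤ l) :
    constB l u * (((2 * u).factorial : ℝ) / (2 ^ u * (u.factorial : ℝ))) =
      (√Real.pi)⁻¹ * (√(polarNorm 0 l u))⁻¹ := by
  have h0 : (0 : ℝ) ≤ ((2 * u).factorial : ℝ) / (2 ^ u * (u.factorial : ℝ)) := by positivity
  rw [← Real.sqrt_inv, ← Real.sqrt_inv, ← Real.sqrt_mul (by positivity), constB,
    ← Real.sqrt_sq h0, ← Real.sqrt_mul (by positivity)]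
  congr 1
  obtain ⟨k, rfl⟩ := Nat.exists_eq_add_of_le hul
  have hG := Gamma_nat_add_half_sq u
  rw [polarNorm, show 0 + 1 + 2 * u = 2 * u + 1 by ring, cosIntegral_sq,
    show u + k - u = k by omega, inv_div, show u + k + u = k + 2 * u by ring,
    show (((2 * u : ℕ) : ℝ) + 1) / 2 = (u : ℝ) + 1 / 2 by push_cast; ring]
  have hG0 : 0 < Real.Gamma ((u : ℝ) + 1 / 2) := Real.Gamma_pos_of_pos (by positivity)
  have h16 : (4 : ℝ) ^ u = 2 ^ u * 2 ^ u := by rw [← mul_pow]; norm_num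
  have hfac : ((2 * u).factorial : ℝ) ^ 2 =
      Real.Gamma ((u : ℝ) + 1 / 2) ^ 2 * (4 ^ u * u.factorial) ^ 2 / Real.pi := by
    rw [hG]
    field_simp
  rw [div_pow, hfac, h16]
  push_cast
  field_simp
  ring

/-! ### Azimuthal factors and the product form of the harmonics. -/

/-- The normalised azimuthal factor of a hyperspherical harmonic. -/
noncomputable def azimuth (ν : ℤ) (φ : ℝ) : ℝ :=
  (-1) ^ ν.natAbs * (√Real.pi)⁻¹ * (if 0 < ν then Real.cos (ν.natAbs * φ)
    else if ν < 0 then Real.sin (ν.natAbs * φ) else 1 / √2)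

@[fun_prop]
theorem continuous_azimuth (ν : ℤ) : Continuous (azimuth ν) := by
  unfold azimuth
  split_ifs <;> fun_prop

/-- The sequence `μ_1, …, μ_{m-3}, u`. -/
def nextIndex {n : ℕ} (μ : Fin (n + 1) → ℕ) (u : ℕ) (i : Fin (n + 1)) : ℕ :=
  Fin.lastCases (motive := fun _ => ℕ) u (fun i => μ i.succ) i

@[simp]
theorem nextIndex_castSucc {n : ℕ} (μ : Fin (n + 1) → ℕ) (u : ℕ) (i : Fin n) :
    nextIndex μ u i.castSucc = μ i.succ := by
  simp [nextIndex]

@[simp]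
theorem nextIndex_last {n : ℕ} (μ : Fin (n + 1) → ℕ) (u : ℕ) :
    nextIndex μ u (Fin.last n) = u := by
  simp [nextIndex]

theorem hyperHarmonic_eq_prod {n : ℕ} {μ : Fin (n + 1) → ℕ} {ν : ℤ}
    (hμ : ∀ i : Fin n, μ i.succ ≤ μ i.castSucc) (hν : ν.natAbs ≤ μ (Fin.last n)) (x : Angles n) :
    hyperHarmonic n μ ν x =
      (∏ i : Fin (n + 1), polar (n - i) (μ i) (nextIndex μ ν.natAbs i) (x.1 i)) *
        azimuth ν x.2 := by
  rw [Fin.prod_univ_castSucc, hyperHarmonic]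
  have h1 : ∀ i : Fin n, constA (n + 3) (i + 1) (μ i.castSucc) (μ i.succ) *
      ((gegenbauer (μ i.castSucc - μ i.succ)
          (μ i.succ + (((n + 3 : ℕ) : ℝ) - ((i + 1 : ℕ) : ℝ) - 1) / 2)).eval
            (Real.cos (x.1 i.castSucc)) *
        Real.sin (x.1 i.castSucc) ^ μ i.succ) =
      polar (n - i.castSucc) (μ i.castSucc) (nextIndex μ ν.natAbs i.castSucc)
        (x.1 i.castSucc) := by
    intro i
    have hi := i.isLt
    have hA := constA_eq i (n - i) (by omega) (hμ i)
    rw [show (i : ℕ) + (n - i) + 3 = n + 3 by omega] at hA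
    rw [hA, nextIndex_castSucc, polar, ultraspherical]
    congr 4
    have : ((n - (i : ℕ) : ℕ) : ℝ) = n - i := by rw [Nat.cast_sub hi.le]
    simp only [Fin.val_castSucc]
    push_cast
    rw [this]
    ring
  rw [Finset.prod_congr rfl fun i _ => h1 i]
  generalize (∏ i : Fin n, polar (n - i.castSucc) (μ i.castSucc)
    (nextIndex μ ν.natAbs i.castSucc) (x.1 i.castSucc)) = A
  rw [nextIndex_last]
  unfold legendreCos azimuth polar ultraspherical
  have hB := constB_mul_eq hν
  simp only [Fin.val_last, Nat.sub_self]
  have hα : (((0 + 1 + 2 * ν.natAbs : ℕ) : ℝ)) / 2 = (ν.natAbs : ℝ) + 1 / 2 := by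
    push_cast
    ring
  rw [hα]
  generalize (gegenbauer (μ (Fin.last n) - ν.natAbs) ((ν.natAbs : ℝ) + 1 / 2)).eval
    (Real.cos (x.1 (Fin.last n))) = g
  generalize Real.sin (x.1 (Fin.last n)) ^ ν.natAbs = s
  generalize (if 0 < ν then Real.cos (ν.natAbs * x.2)
    else if ν < 0 then Real.sin (ν.natAbs * x.2) else 1 / √2) = T
  linear_combination (A * (-1) ^ ν.natAbs * s * g * T) * hB

theorem integral_cos_int_mul (k : ℤ) : (∫ φ in (-Real.pi)..Real.pi, Real.cos (k * φ)) =
    if k = 0 then 2 * Real.pi else 0 := by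
  split_ifs with h
  · subst h
    simp
    ring
  · have hk : (k : ℝ) ≠ 0 := by exact_mod_cast h
    rw [intervalIntegral.integral_comp_mul_left (fun y => Real.cos y) hk, integral_cos]
    have : Real.sin ((k : ℝ) * -Real.pi) = 0 := by
      rw [mul_neg, Real.sin_neg, Real.sin_int_mul_pi, neg_zero]
    rw [this, Real.sin_int_mul_pi]
    simp

theorem integral_sin_int_mul (k : ℤ) : (∫ φ in (-Real.pi)..Real.pi, Real.sin (k * φ)) = 0 := by
  have h := intervalIntegral.integral_comp_neg (a := -Real.pi) (b := Real.pi)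
    (fun φ => Real.sin (k * φ))
  simp only [mul_neg, Real.sin_neg, intervalIntegral.integral_neg, neg_neg] at h
  linarith

theorem integral_cos_mul_cos (k l : ℤ) :
    (∫ φ in (-Real.pi)..Real.pi, Real.cos (k * φ) * Real.cos (l * φ)) =
      ((if k - l = 0 then 2 * Real.pi else 0) + if k + l = 0 then 2 * Real.pi else 0) / 2 := by
  have h : ∀ φ : ℝ, Real.cos (k * φ) * Real.cos (l * φ) =
      (Real.cos (((k - l : ℤ) : ℝ) * φ) + Real.cos (((k + l : ℤ) : ℝ) * φ)) / 2 := by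
    intro φ
    push_cast
    rw [sub_mul, add_mul, Real.cos_sub, Real.cos_add]
    ring
  simp_rw [h]
  rw [intervalIntegral.integral_div, intervalIntegral.integral_add
    (Continuous.intervalIntegrable (by fun_prop) _ _)
    (Continuous.intervalIntegrable (by fun_prop) _ _), integral_cos_int_mul, integral_cos_int_mul]

theorem integral_sin_mul_sin (k l : ℤ) :
    (∫ φ in (-Real.pi)..Real.pi, Real.sin (k * φ) * Real.sin (l * φ)) =
      ((if k - l = 0 then 2 * Real.pi else 0) - if k + l = 0 then 2 * Real.pi else 0) / 2 := by
  have h : ∀ φ : ℝ, Real.sin (k * φ) * Real.sin (l * φ) =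
      (Real.cos (((k - l : ℤ) : ℝ) * φ) - Real.cos (((k + l : ℤ) : ℝ) * φ)) / 2 := by
    intro φ
    push_cast
    rw [sub_mul, add_mul, Real.cos_sub, Real.cos_add]
    ring
  simp_rw [h]
  rw [intervalIntegral.integral_div, intervalIntegral.integral_sub
    (Continuous.intervalIntegrable (by fun_prop) _ _)
    (Continuous.intervalIntegrable (by fun_prop) _ _), integral_cos_int_mul, integral_cos_int_mul]

theorem integral_sin_mul_cos_eq_zero (k l : ℤ) :
    (∫ φ in (-Real.pi)..Real.pi, Real.sin (k * φ) * Real.cos (l * φ)) = 0 := by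
  have h : ∀ φ : ℝ, Real.sin (k * φ) * Real.cos (l * φ) =
      (Real.sin (((k - l : ℤ) : ℝ) * φ) + Real.sin (((k + l : ℤ) : ℝ) * φ)) / 2 := by
    intro φ
    push_cast
    rw [sub_mul, add_mul, Real.sin_sub, Real.sin_add]
    ring
  simp_rw [h]
  rw [intervalIntegral.integral_div, intervalIntegral.integral_add
    (Continuous.intervalIntegrable (by fun_prop) _ _)
    (Continuous.intervalIntegrable (by fun_prop) _ _), integral_sin_int_mul, integral_sin_int_mul]
  simp

/-- The azimuthal factor in terms of trigonometric functions of integral frequency. -/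
theorem azimuth_eq (ν : ℤ) (φ : ℝ) : azimuth ν φ = (-1) ^ ν.natAbs * (√Real.pi)⁻¹ *
    (if 0 < ν then Real.cos (ν * φ)
      else if ν < 0 then - Real.sin (ν * φ) else 1 / √2 * Real.cos (ν * φ)) := by
  unfold azimuth
  congr 1
  split_ifs with h1 h2
  · rw [show ((ν.natAbs : ℕ) : ℝ) = ν by
      rw [Nat.cast_natAbs, abs_of_pos h1]]
  · rw [show ((ν.natAbs : ℕ) : ℝ) = -ν by
      rw [Nat.cast_natAbs, abs_of_neg h2]; push_cast; rfl]
    rw [neg_mul, Real.sin_neg]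
  · have : ν = 0 := by omega
    simp [this]

theorem integral_azimuth_mul_azimuth (ν ν' : ℤ) :
    (∫ φ in (-Real.pi)..Real.pi, azimuth ν φ * azimuth ν' φ) = if ν = ν' then 1 else 0 := by
  have hpi : (√Real.pi)⁻¹ * (√Real.pi)⁻¹ = Real.pi⁻¹ := by
    rw [← mul_inv, Real.mul_self_sqrt Real.pi_pos.le]
  have hpi0 := Real.pi_pos.ne'
  have h2 : √2 ^ 2 = (2 : ℝ) := Real.sq_sqrt (by norm_num)
  have hcc := integral_cos_mul_cos ν ν'
  have hss := integral_sin_mul_sin ν ν'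
  have hsc := integral_sin_mul_cos_eq_zero ν ν'
  have hcs := integral_sin_mul_cos_eq_zero ν' ν
  have hred : ∀ (T T' : ℝ → ℝ) (c c' : ℝ), (∀ φ, azimuth ν φ = c * T φ) →
      (∀ φ, azimuth ν' φ = c' * T' φ) →
      (∫ φ in (-Real.pi)..Real.pi, azimuth ν φ * azimuth ν' φ) =
        c * c' * ∫ φ in (-Real.pi)..Real.pi, T φ * T' φ := by
    intro T T' c c' h h'
    rw [← intervalIntegral.integral_const_mul]
    refine intervalIntegral.integral_congr fun φ _ => ?_
    simp only [h, h']
    ring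
  -- Only c² matters: for ν = ν' the integral contains c c' = c², and otherwise the trigonometric
  -- integral is 0.
  have hform : ∀ ν : ℤ, ∃ (c : ℝ), c ^ 2 = Real.pi⁻¹ * (if ν = 0 then 1 / 2 else 1) ∧
      ((0 ≤ ν ∧ ∀ φ, azimuth ν φ = c * Real.cos (ν * φ)) ∨
        (ν < 0 ∧ ∀ φ, azimuth ν φ = c * Real.sin (ν * φ))) := by
    intro ν
    have hone : ((-1 : ℝ) ^ ν.natAbs) ^ 2 = 1 := by rw [← pow_mul, mul_comm, pow_mul]; simp
    have hpi2 : ((√Real.pi)⁻¹) ^ 2 = Real.pi⁻¹ := by rw [sq, hpi]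
    rcases lt_trichotomy ν 0 with h | h | h
    · refine ⟨-((-1) ^ ν.natAbs * (√Real.pi)⁻¹), ?_, Or.inr ⟨h, fun φ => ?_⟩⟩
      · rw [neg_sq, mul_pow, hone, hpi2, if_neg h.ne]
        ring
      · rw [azimuth_eq, if_neg h.le.not_gt, if_pos h]
        ring
    · refine ⟨(-1) ^ ν.natAbs * (√Real.pi)⁻¹ * (1 / √2), ?_, Or.inl ⟨h.ge, fun φ => ?_⟩⟩
      · rw [mul_pow, mul_pow, hone, hpi2, if_pos h, div_pow, h2]
        ring
      · rw [azimuth_eq, if_neg h.le.not_gt, if_neg h.ge.not_gt]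
        ring
    · refine ⟨(-1) ^ ν.natAbs * (√Real.pi)⁻¹, ?_, Or.inl ⟨h.le, fun φ => ?_⟩⟩
      · rw [mul_pow, hone, hpi2, if_neg h.ne']
        ring
      · rw [azimuth_eq, if_pos h]
  by_cases heq : ν = ν'
  · subst heq
    obtain ⟨c, hc, ⟨h, hT⟩ | ⟨h, hT⟩⟩ := hform ν
    · rw [hred _ _ _ _ hT hT, hcc, ← sq, hc]
      by_cases h0 : ν = 0
      · simp [h0]
        field_simp
      · have : ν + ν ≠ 0 := by omega
        simp [h0, this]
    · have : ν + ν ≠ 0 := by omega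
      rw [hred _ _ _ _ hT hT, hss, ← sq, hc]
      simp [h.ne, this]
  · rw [if_neg heq]
    have hd : ν - ν' ≠ 0 := sub_ne_zero.2 heq
    obtain ⟨c, -, ⟨h, hT⟩ | ⟨h, hT⟩⟩ := hform ν <;>
      obtain ⟨c', -, ⟨h', hT'⟩ | ⟨h', hT'⟩⟩ := hform ν'
    · rw [hred _ _ _ _ hT hT', hcc, if_neg hd, if_neg (by omega)]
      simp
    · rw [hred _ _ _ _ hT hT', ← mul_zero (c * c'), ← hcs]
      simp_rw [mul_comm (Real.cos _)]
    · rw [hred _ _ _ _ hT hT', hsc, mul_zero]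
    · rw [hred _ _ _ _ hT hT', hss, if_neg hd, if_neg (by omega)]
      simp

/-! ### Index sets, their recursion in the dimension, and counting. -/

theorem mem_indexSet {n d : ℕ} {a : (Fin (n + 1) → ℕ) × ℤ} : a ∈ indexSet n d ↔
    a.1 0 ≤ d ∧ (∀ i : Fin n, a.1 i.succ ≤ a.1 i.castSucc) ∧
      a.2.natAbs ≤ a.1 (Fin.last n) := by
  have habs : |a.2| ≤ (a.1 (Fin.last n) : ℤ) ↔ a.2.natAbs ≤ a.1 (Fin.last n) := by
    rw [Int.abs_eq_natAbs]
    exact Int.ofNat_le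
  simp only [indexSet, Finset.mem_filter, Finset.mem_product, Fintype.mem_piFinset,
    Finset.mem_range, Finset.mem_Icc, habs]
  constructor
  · rintro ⟨⟨h1, -⟩, h2, h3⟩
    exact ⟨Nat.lt_succ_iff.1 (h1 0), h2, h3⟩
  · rintro ⟨h1, h2, h3⟩
    have h4 : ∀ i, a.1 i ≤ d := fun i =>
      ((Fin.antitone_iff_succ_le.2 h2) (Fin.zero_le i)).trans h1
    have := h4 (Fin.last n)
    exact ⟨⟨fun i => Nat.lt_succ_of_le (h4 i), by omega, by omega⟩, h2, h3⟩

/-- The indices of level `l`. -/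
noncomputable def levelSet (n l : ℕ) : Finset ((Fin (n + 1) → ℕ) × ℤ) :=
  (indexSet n l).filter fun a => a.1 0 = l

theorem mem_levelSet {n l : ℕ} {a : (Fin (n + 1) → ℕ) × ℤ} : a ∈ levelSet n l ↔
    a.1 0 = l ∧ (∀ i : Fin n, a.1 i.succ ≤ a.1 i.castSucc) ∧
      a.2.natAbs ≤ a.1 (Fin.last n) := by
  rw [levelSet, Finset.mem_filter, mem_indexSet]
  constructor
  · rintro ⟨⟨-, h⟩, h'⟩
    exact ⟨h', h⟩
  · rintro ⟨h', h⟩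
    exact ⟨⟨h'.le, h⟩, h'⟩

theorem filter_indexSet_eq_levelSet {n d l : ℕ} (hl : l ≤ d) :
    ((indexSet n d).filter fun a => a.1 0 = l) = levelSet n l := by
  ext a
  rw [Finset.mem_filter, mem_indexSet, mem_levelSet]
  constructor
  · rintro ⟨⟨-, h⟩, h'⟩
    exact ⟨h', h⟩
  · rintro ⟨h', h⟩
    exact ⟨⟨h'.le.trans hl, h⟩, h'⟩

theorem sum_levelSet_zero (l : ℕ) (f : (Fin 1 → ℕ) × ℤ → ℝ) :
    ∑ a ∈ levelSet 0 l, f a = ∑ ν ∈ Finset.Icc (-(l : ℤ)) l, f (fun _ => l, ν) := by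
  symm
  refine Finset.sum_nbij' (fun ν => (fun _ => l, ν)) (fun a => a.2) ?_ ?_ ?_ ?_ ?_
  · intro ν hν
    rw [Finset.mem_Icc] at hν
    rw [mem_levelSet]
    exact ⟨rfl, fun i => i.elim0, by simp only; omega⟩
  · rintro ⟨μ, ν⟩ h
    rw [mem_levelSet] at h
    obtain ⟨h1, -, h2⟩ := h
    simp only [Fin.last_zero] at h1 h2
    simp only [Finset.mem_Icc]
    omega
  · intro ν _
    rfl
  · rintro ⟨μ, ν⟩ h
    rw [mem_levelSet] at h
    ext i
    · rw [Fin.fin_one_eq_zero i]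
      exact h.1.symm
    · rfl
  · intro ν _
    rfl

/-- Deleting μ_0 = l leaves an index of level b = μ_1 ≤ l one dimension lower. Both the count and
the addition theorem are inductions on this recursion. -/
theorem sum_levelSet_succ (n l : ℕ) (f : (Fin (n + 2) → ℕ) × ℤ → ℝ) :
    ∑ a ∈ levelSet (n + 1) l, f a =
      ∑ b ∈ Finset.range (l + 1), ∑ a ∈ levelSet n b, f (Fin.cons l a.1, a.2) := by
  rw [Finset.sum_sigma']
  refine Finset.sum_nbij' (fun a => ⟨a.1 1, (fun i => a.1 i.succ, a.2)⟩)
    (fun c => (Fin.cons l c.2.1, c.2.2)) ?_ ?_ ?_ ?_ ?_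
  · rintro ⟨μ, ν⟩ h
    rw [mem_levelSet] at h
    obtain ⟨h1, h2, h3⟩ := h
    simp only at h1 h2 h3
    rw [Finset.mem_sigma, mem_levelSet, Finset.mem_range]
    refine ⟨?_, rfl, fun i => ?_, ?_⟩
    · have := h2 0
      simp only [Fin.castSucc_zero, h1] at this
      exact Nat.lt_succ_of_le this
    · simpa using h2 i.succ
    · simpa using h3
  · rintro ⟨b, μ, ν⟩ h
    rw [Finset.mem_sigma, mem_levelSet, Finset.mem_range] at h
    obtain ⟨h0, h1, h2, h3⟩ := h
    simp only at h0 h1 h2 h3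
    rw [mem_levelSet]
    refine ⟨rfl, fun i => ?_, ?_⟩
    · refine Fin.cases ?_ (fun i => ?_) i
      · simp only [Fin.cons_succ, Fin.castSucc_zero, Fin.cons_zero]
        omega
      · simpa using h2 i
    · simpa [← Fin.succ_last] using h3
  · rintro ⟨μ, ν⟩ h
    rw [mem_levelSet] at h
    ext i
    · refine Fin.cases ?_ (fun i => ?_) i
      · exact h.1.symm
      · rfl
    · rfl
  · rintro ⟨b, μ, ν⟩ h
    rw [Finset.mem_sigma, mem_levelSet] at h
    obtain rfl : μ 0 = b := h.2.1
    rfl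
  · rintro ⟨μ, ν⟩ h
    rw [mem_levelSet] at h
    congr 2
    funext i
    refine Fin.cases ?_ (fun i => ?_) i
    · exact h.1
    · rfl

theorem cast_levelDim (n k : ℕ) : (levelDim (n + 3) k : ℝ) =
    ((n : ℝ) + 1 + 2 * k) * (k + n).factorial / (k.factorial * (n + 1).factorial) := by
  have h := levelDim_exact (n + 3) k (by omega)
  rw [levelDim, Nat.cast_div h (by positivity)]
  rw [show n + 3 + 2 * k - 2 = n + 1 + 2 * k by omega, show k + (n + 3) - 3 = k + n by omega,
    show n + 3 - 2 = n + 1 by omega]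
  push_cast
  rfl

theorem levelDim_pos (n k : ℕ) : 0 < levelDim (n + 3) k := by
  have : (0 : ℝ) < levelDim (n + 3) k := by
    rw [cast_levelDim]
    positivity
  exact_mod_cast this

theorem sum_levelDim (n l : ℕ) :
    ∑ b ∈ Finset.range (l + 1), (levelDim (n + 3) b : ℝ) = levelDim (n + 4) l := by
  induction l with
  | zero =>
    rw [cast_levelDim (n + 1)]
    simp only [zero_add, Finset.sum_range_one]
    rw [cast_levelDim]
    simp only [Nat.factorial_succ, zero_add, Nat.factorial_zero]
    push_cast
    field_simp
    ring
  | succ l ih =>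
    rw [Finset.sum_range_succ, ih, cast_levelDim n, cast_levelDim (n + 1), cast_levelDim (n + 1),
      show l + 1 + (n + 1) = (l + n + 1) + 1 by ring, show l + (n + 1) = l + n + 1 by ring,
      show l + 1 + n = l + n + 1 by ring, Nat.factorial_succ (l + n + 1), Nat.factorial_succ l,
      Nat.factorial_succ (n + 1)]
    push_cast
    field_simp
    ring

theorem card_levelSet (n l : ℕ) : (levelSet n l).card = levelDim (n + 3) l := by
  suffices h : ((levelSet n l).card : ℝ) = levelDim (n + 3) l by exact_mod_cast h
  have h1 : ∀ n l : ℕ, ((levelSet n l).card : ℝ) = ∑ a ∈ levelSet n l, (1 : ℝ) := by simp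
  induction n generalizing l with
  | zero =>
    rw [h1, sum_levelSet_zero, cast_levelDim]
    simp only [Finset.sum_const, Int.card_Icc, nsmul_eq_mul, mul_one]
    have h2 : ((l : ℤ) + 1 - -l).toNat = 1 + 2 * l := by omega
    rw [h2]
    push_cast
    simp
    field_simp
  | succ n ih =>
    rw [h1, sum_levelSet_succ, ← sum_levelDim]
    refine Finset.sum_congr rfl fun b _ => ?_
    rw [← ih, h1]

/-! ### Fubini on the box and the addition theorem. -/

theorem volume_restrict_angleBox (n : ℕ) : (volume : Measure (Angles n)).restrict (angleBox n) =
    (Measure.pi fun _ : Fin (n + 1) => volume.restrict (Set.Icc 0 Real.pi)).prod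
      (volume.restrict (Set.Icc (-Real.pi) Real.pi)) := by
  rw [angleBox, Measure.volume_eq_prod, ← Measure.prod_restrict, volume_pi, Measure.restrict_pi_pi]

theorem setIntegral_angleBox (n : ℕ) (F : Fin (n + 1) → ℝ → ℝ) (g : ℝ → ℝ) :
    ∫ x in angleBox n, (∏ i, F i (x.1 i)) * g x.2 =
      (∏ i, ∫ t in (0 : ℝ)..Real.pi, F i t) * ∫ φ in (-Real.pi)..Real.pi, g φ := by
  rw [volume_restrict_angleBox, integral_prod_mul (fun y : Fin (n + 1) → ℝ => ∏ i, F i (y i)) g,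
    integral_fintype_prod_eq_prod, intervalIntegral.integral_of_le (by linarith [Real.pi_pos]),
    integral_Icc_eq_integral_Ioc]
  congr 1
  refine Finset.prod_congr rfl fun i _ => ?_
  rw [intervalIntegral.integral_of_le Real.pi_pos.le, integral_Icc_eq_integral_Ioc]

theorem totalAngle_eq_prod (n : ℕ) : totalAngle n =
    2 * Real.pi * ∏ i : Fin (n + 1), ∫ t in (0 : ℝ)..Real.pi, Real.sin t ^ (n + 1 - (i : ℕ)) := by
  have h := setIntegral_angleBox n (fun i t => Real.sin t ^ (n + 1 - (i : ℕ))) fun _ => 1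
  simp only [mul_one] at h
  rw [totalAngle]
  unfold solidAngle
  rw [h]
  simp
  ring

theorem totalAngle_succ (n : ℕ) : totalAngle (n + 1) =
    (∫ t in (0 : ℝ)..Real.pi, Real.sin t ^ (n + 1 + 1)) * totalAngle n := by
  rw [totalAngle_eq_prod (n + 1), totalAngle_eq_prod n, Fin.prod_univ_succ (n := n + 1)]
  simp only [Fin.val_zero, Nat.sub_zero, Fin.val_succ, Nat.add_sub_add_right]
  ring

theorem hyperHarmonic_cons {n l : ℕ} {μ : Fin (n + 1) → ℕ} {ν : ℤ} (hl : μ 0 ≤ l)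
    (hμ : ∀ i : Fin n, μ i.succ ≤ μ i.castSucc) (hν : ν.natAbs ≤ μ (Fin.last n))
    (x : Angles (n + 1)) :
    hyperHarmonic (n + 1) (Fin.cons l μ) ν x = polar (n + 1) l (μ 0) (x.1 0) *
      hyperHarmonic n μ ν (fun i => x.1 i.succ, x.2) := by
  rw [hyperHarmonic_eq_prod hμ hν, hyperHarmonic_eq_prod, Fin.prod_univ_succ, mul_assoc]
  · congr 2
    · have : nextIndex (Fin.cons l μ : Fin (n + 2) → ℕ) ν.natAbs 0 = μ 0 := by
        rw [← Fin.castSucc_zero, nextIndex_castSucc]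
        rfl
      rw [this]
    · refine Finset.prod_congr rfl fun i _ => ?_
      have : nextIndex (Fin.cons l μ : Fin (n + 2) → ℕ) ν.natAbs i.succ =
          nextIndex μ ν.natAbs i := by
        refine Fin.lastCases ?_ (fun i => ?_) i
        · rw [Fin.succ_last, nextIndex_last, nextIndex_last]
        · rw [Fin.succ_castSucc, nextIndex_castSucc, nextIndex_castSucc, Fin.cons_succ]
      rw [this]
      simp
  · intro i
    refine Fin.cases ?_ (fun i => ?_) i
    · simpa using hl
    · simpa using hμ i
  · simpa [← Fin.succ_last] using hν

theorem azimuth_sq_add_sq {u : ℕ} (hu : 0 < u) (φ : ℝ) :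
    azimuth u φ ^ 2 + azimuth (-(u : ℤ)) φ ^ 2 = Real.pi⁻¹ := by
  have hone : ((-1 : ℝ) ^ u) ^ 2 = 1 := by rw [← pow_mul, mul_comm, pow_mul]; simp
  have hpi : ((√Real.pi)⁻¹) ^ 2 = Real.pi⁻¹ := by
    rw [inv_pow, Real.sq_sqrt Real.pi_pos.le]
  have h1 : (0 : ℤ) < u := by exact_mod_cast hu
  have h2 : ¬ (0 : ℤ) < -(u : ℤ) := by omega
  have h3 : -(u : ℤ) < 0 := by omega
  simp only [azimuth, if_pos h1, if_neg h2, if_pos h3, Int.natAbs_neg, Int.natAbs_natCast, mul_pow,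
    hone, hpi]
  rw [← mul_add, Real.cos_sq_add_sin_sq]
  ring

theorem azimuth_zero_sq (φ : ℝ) : azimuth 0 φ ^ 2 = Real.pi⁻¹ / 2 := by
  have hpi : ((√Real.pi)⁻¹) ^ 2 = Real.pi⁻¹ := by
    rw [inv_pow, Real.sq_sqrt Real.pi_pos.le]
  have h2 : √2 ^ 2 = (2 : ℝ) := Real.sq_sqrt (by norm_num)
  simp only [azimuth, lt_irrefl, if_false, mul_pow, hpi, div_pow, h2]
  simp
  ring

/-- The pair ±u contributes cos² + sin² = 1; ν = 0 is unpaired and contributes (1/√2)² = 1/2. -/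
theorem sum_Icc_natAbs (l : ℕ) (g : ℕ → ℝ) (φ : ℝ) :
    ∑ ν ∈ Finset.Icc (-(l : ℤ)) l, g ν.natAbs * azimuth ν φ ^ 2 =
      Real.pi⁻¹ * ∑ u ∈ Finset.range (l + 1), (if u = 0 then 1 / 2 else 1) * g u := by
  induction l with
  | zero =>
    simp [azimuth_zero_sq]
    ring
  | succ l ih =>
    have h : Finset.Icc (-((l + 1 : ℕ) : ℤ)) ((l + 1 : ℕ) : ℤ) =
        insert (((l + 1 : ℕ) : ℤ)) (insert (-((l + 1 : ℕ) : ℤ)) (Finset.Icc (-(l : ℤ)) l)) := by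
      ext ν
      simp only [Finset.mem_insert, Finset.mem_Icc]
      omega
    rw [h, Finset.sum_insert, Finset.sum_insert, ih, Finset.sum_range_succ _ (l + 1),
      if_neg (Nat.succ_ne_zero l), mul_add, ← azimuth_sq_add_sq (Nat.succ_pos l) φ]
    · rw [Int.natAbs_neg, Int.natAbs_natCast]
      simp only [Nat.succ_eq_add_one]
      have := azimuth_sq_add_sq (Nat.succ_pos l) φ
      rw [this]
      simp only [Nat.succ_eq_add_one] at this
      linear_combination (g (l + 1)) * this
    · simp only [Finset.mem_Icc]
      omega
    · simp only [Finset.mem_insert, Finset.mem_Icc]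
      omega

/-- The addition theorem for real hyperspherical harmonics, on the diagonal. -/
theorem sum_levelSet_hyperHarmonic_sq (n l : ℕ) (x : Angles n) :
    ∑ a ∈ levelSet n l, hyperHarmonic n a.1 a.2 x ^ 2 = levelDim (n + 3) l / totalAngle n := by
  induction n generalizing l with
  | zero =>
    rw [sum_levelSet_zero]
    have h1 : ∀ ν ∈ Finset.Icc (-(l : ℤ)) l, hyperHarmonic 0 (fun _ => l) ν x ^ 2 =
        polar 0 l ν.natAbs (x.1 0) ^ 2 * azimuth ν x.2 ^ 2 := by
      intro ν hν
      rw [Finset.mem_Icc] at hν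
      rw [hyperHarmonic_eq_prod (fun i => i.elim0) (by omega), mul_pow]
      have := nextIndex_last (n := 0) (fun _ => l) ν.natAbs
      simp only [Fin.last_zero] at this
      simp [this]
    -- The case N = 0 of the one-variable result: the weights 1/2, 1, 1, … come from pairing ±ν, and
    -- w is 1 at 0 and 1/2 afterwards.
    rw [Finset.sum_congr rfl h1, sum_Icc_natAbs l (fun u => polar 0 l u (x.1 0) ^ 2),
      sum_polar_sq 0 l (fun u => if u = 0 then 1 / 2 else 1) (fun u => if u = 0 then 1 else 1 / 2)
        rfl ?_ ?_, totalAngle_eq_prod, cast_levelDim]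
    · rw [Finset.sum_range_succ']
      simp
      field_simp
      ring
    · intro b
      split_ifs with hb
      · simp [hb]
      · push_cast
        ring
    · intro b _
      rcases b with _ | b
      · norm_num
      · simp
        norm_num
  | succ n ih =>
    rw [sum_levelSet_succ]
    have h1 : ∀ b ∈ Finset.range (l + 1), ∑ a ∈ levelSet n b,
        hyperHarmonic (n + 1) (Fin.cons l a.1) a.2 x ^ 2 =
          (totalAngle n)⁻¹ * (levelDim (n + 3) b * polar (n + 1) l b (x.1 0) ^ 2) := by
      intro b hb
      rw [Finset.mem_range] at hb
      have h2 : ∀ a ∈ levelSet n b, hyperHarmonic (n + 1) (Fin.cons l a.1) a.2 x ^ 2 =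
          polar (n + 1) l b (x.1 0) ^ 2 *
            hyperHarmonic n a.1 a.2 (fun i => x.1 i.succ, x.2) ^ 2 := by
        intro a ha
        rw [mem_levelSet] at ha
        obtain ⟨h3, h4, h5⟩ := ha
        rw [hyperHarmonic_cons (by omega) h4 h5, h3, mul_pow]
      rw [Finset.sum_congr rfl h2, ← Finset.mul_sum, ih]
      ring
    -- The weights are now the level dimensions one dimension lower, with N = n + 1 and w b = (b +
    -- N)/(2b + N); both sides of the balance condition equal (b + N)!/(b! N!).
    rw [Finset.sum_congr rfl h1, ← Finset.mul_sum,
      sum_polar_sq (n + 1) l (fun b => (levelDim (n + 3) b : ℝ))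
        (fun b => (b + (n + 1 : ℕ)) / (2 * b + (n + 1 : ℕ))) ?_ ?_ ?_, sum_levelDim,
      totalAngle_succ]
    · rw [div_eq_mul_inv, div_eq_mul_inv, mul_inv]
      ring
    · have : ((n + 1 : ℕ) : ℝ) ≠ 0 := by positivity
      simp only [Nat.cast_zero, mul_zero, zero_add]
      exact div_self this
    · intro b
      have : (2 * (b : ℝ) + (n + 1 : ℕ)) ≠ 0 := by positivity
      field_simp
    · intro b _
      rw [cast_levelDim, cast_levelDim, show b + 1 + n = b + n + 1 by ring,
        Nat.factorial_succ (b + n), Nat.factorial_succ b]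
      push_cast
      field_simp
      ring

theorem totalAngle_pos (n : ℕ) : 0 < totalAngle n := by
  rw [totalAngle_eq_prod]
  exact mul_pos (by positivity) (Finset.prod_pos fun i _ => integral_sin_pow_pos _)

/-- The Gamma quotients of the single integrals telescope. -/
theorem prod_integral_sin_pow (k : ℕ) :
    ∏ i : Fin k, (∫ t in (0 : ℝ)..Real.pi, Real.sin t ^ (k - (i : ℕ))) =
      √Real.pi ^ k / Real.Gamma ((k : ℝ) / 2 + 1) := by
  induction k with
  | zero => simp
  | succ k ih =>
    rw [Fin.prod_univ_succ]
    simp only [Fin.val_zero, Nat.sub_zero, Fin.val_succ, Nat.add_sub_add_right]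
    rw [ih, integral_sin_pow_eq_Gamma,
      show (((k + 1 : ℕ) : ℝ) + 1) / 2 = (k : ℝ) / 2 + 1 by push_cast; ring]
    have : Real.Gamma ((k : ℝ) / 2 + 1) ≠ 0 := (Real.Gamma_pos_of_pos (by positivity)).ne'
    rw [pow_succ]
    field_simp

theorem totalAngle_eq_Gamma (n : ℕ) : totalAngle n =
    2 * Real.pi ^ (((n + 3 : ℕ) : ℝ) / 2) / Real.Gamma (((n + 3 : ℕ) : ℝ) / 2) := by
  rw [totalAngle_eq_prod, prod_integral_sin_pow,
    show ((n + 3 : ℕ) : ℝ) / 2 = ((n + 1 : ℕ) : ℝ) / 2 + 1 by push_cast; ring,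
    Real.rpow_add Real.pi_pos, Real.rpow_one, Real.rpow_div_two_eq_sqrt _ Real.pi_pos.le,
    Real.rpow_natCast]
  ring

/-! ### The uniform design and its information matrix. -/

theorem measurableSet_angleBox (n : ℕ) : MeasurableSet (angleBox n) :=
  (MeasurableSet.univ_pi fun _ => measurableSet_Icc).prod measurableSet_Icc

theorem isCompact_angleBox (n : ℕ) : IsCompact (angleBox n) :=
  (isCompact_univ_pi fun _ => isCompact_Icc).prod isCompact_Icc

theorem continuous_solidAngle (n : ℕ) : Continuous (solidAngle n) := by
  unfold solidAngle
  fun_prop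

theorem solidAngle_nonneg {n : ℕ} {x : Angles n} (hx : x ∈ angleBox n) : 0 ≤ solidAngle n x :=
  Finset.prod_nonneg fun i _ =>
    pow_nonneg (Real.sin_nonneg_of_mem_Icc (hx.1 i (Set.mem_univ i))) _

theorem integral_uniformDesign (n : ℕ) (h : Angles n → ℝ) :
    ∫ x, h x ∂(uniformDesign n) =
      (totalAngle n)⁻¹ * ∫ x in angleBox n, h x * solidAngle n x := by
  rw [uniformDesign, integral_withDensity_eq_integral_toReal_smul
    (by have := continuous_solidAngle n; fun_prop) (by simp), ← integral_const_mul]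
  refine setIntegral_congr_fun (measurableSet_angleBox n) fun x hx => ?_
  simp only [smul_eq_mul]
  rw [ENNReal.toReal_ofReal (div_nonneg (solidAngle_nonneg hx) (totalAngle_pos n).le)]
  ring

theorem isDesign_uniformDesign (n : ℕ) : OptDesign.IsDesign (angleBox n) (uniformDesign n) := by
  constructor
  · constructor
    rw [uniformDesign, withDensity_apply _ MeasurableSet.univ, Measure.restrict_univ,
      ← ofReal_integral_eq_lintegral_ofReal]
    · rw [integral_div, ← totalAngle, div_self (totalAngle_pos n).ne', ENNReal.ofReal_one]
    · exact ((continuous_solidAngle n).div_const _).continuousOn.integrableOn_compact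
        (isCompact_angleBox n)
    · filter_upwards [ae_restrict_mem (measurableSet_angleBox n)] with x hx
      exact div_nonneg (solidAngle_nonneg hx) (totalAngle_pos n).le
  · refine withDensity_absolutelyContinuous _ _ ?_
    rw [Measure.restrict_apply (measurableSet_angleBox n).compl, Set.compl_inter_self,
      measure_empty]

theorem mem_indexSet_of_index {n d : ℕ} (a : Index n d) :
    a.1.1 0 ≤ d ∧ (∀ i : Fin n, a.1.1 i.succ ≤ a.1.1 i.castSucc) ∧
      a.1.2.natAbs ≤ a.1.1 (Fin.last n) := mem_indexSet.1 a.2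

theorem nextIndex_le {n : ℕ} {μ : Fin (n + 1) → ℕ} {u : ℕ}
    (hμ : ∀ i : Fin n, μ i.succ ≤ μ i.castSucc) (hu : u ≤ μ (Fin.last n)) (i : Fin (n + 1)) :
    nextIndex μ u i ≤ μ i := by
  refine Fin.lastCases ?_ (fun i => ?_) i
  · simpa using hu
  · simpa using hμ i

theorem continuous_regressors {n d : ℕ} (a : Index n d) : Continuous (regressors n d a) := by
  obtain ⟨-, h2, h3⟩ := mem_indexSet_of_index a
  have : regressors n d a = fun x => (∏ i : Fin (n + 1),
      polar (n - i) (a.1.1 i) (nextIndex a.1.1 a.1.2.natAbs i) (x.1 i)) * azimuth a.1.2 x.2 := by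
    funext x
    exact hyperHarmonic_eq_prod h2 h3 x
  rw [this]
  fun_prop

/-- Orthonormality of the real hyperspherical harmonics. -/
theorem setIntegral_regressors_mul (n d : ℕ) (a b : Index n d) :
    ∫ x in angleBox n, regressors n d a x * regressors n d b x * solidAngle n x =
      if a = b then 1 else 0 := by
  obtain ⟨-, ha2, ha3⟩ := mem_indexSet_of_index a
  obtain ⟨-, hb2, hb3⟩ := mem_indexSet_of_index b
  have h1 : ∀ x, regressors n d a x * regressors n d b x * solidAngle n x =
      (∏ i : Fin (n + 1), polar (n - i) (a.1.1 i) (nextIndex a.1.1 a.1.2.natAbs i) (x.1 i) *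
        polar (n - i) (b.1.1 i) (nextIndex b.1.1 b.1.2.natAbs i) (x.1 i) *
          Real.sin (x.1 i) ^ (n + 1 - (i : ℕ))) * (azimuth a.1.2 x.2 * azimuth b.1.2 x.2) := by
    intro x
    rw [regressors, regressors, hyperHarmonic_eq_prod ha2 ha3, hyperHarmonic_eq_prod hb2 hb3,
      solidAngle, Finset.prod_mul_distrib, Finset.prod_mul_distrib]
    ring
  simp_rw [h1]
  rw [setIntegral_angleBox n (fun i t =>
    polar (n - i) (a.1.1 i) (nextIndex a.1.1 a.1.2.natAbs i) t *
        polar (n - i) (b.1.1 i) (nextIndex b.1.1 b.1.2.natAbs i) t *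
          Real.sin t ^ (n + 1 - (i : ℕ))) fun φ => azimuth a.1.2 φ * azimuth b.1.2 φ,
    integral_azimuth_mul_azimuth]
  by_cases hν : a.1.2 = b.1.2
  swap
  · rw [if_neg hν, if_neg (fun h => hν (by rw [h])), mul_zero]
  rw [if_pos hν, mul_one]
  have h2 : ∀ i : Fin (n + 1),
      nextIndex a.1.1 a.1.2.natAbs i = nextIndex b.1.1 b.1.2.natAbs i →
      (∫ t in (0 : ℝ)..Real.pi, polar (n - i) (a.1.1 i) (nextIndex a.1.1 a.1.2.natAbs i) t *
        polar (n - i) (b.1.1 i) (nextIndex b.1.1 b.1.2.natAbs i) t *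
          Real.sin t ^ (n + 1 - (i : ℕ))) = if a.1.1 i = b.1.1 i then 1 else 0 := by
    intro i hi
    have h3 := nextIndex_le ha2 ha3 i
    have h4 := nextIndex_le hb2 hb3 i
    rw [← hi] at h4 ⊢
    rw [← integral_polar_mul_polar (n - i) h3 h4, show n + 1 - (i : ℕ) = n - i + 1 by omega]
  split_ifs with hab
  · subst hab
    refine Finset.prod_eq_one fun i _ => ?_
    rw [h2 i rfl, if_pos rfl]
  · by_contra hne
    have h5 : ∀ i : Fin (n + 1),
        nextIndex a.1.1 a.1.2.natAbs i = nextIndex b.1.1 b.1.2.natAbs i →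
          a.1.1 i = b.1.1 i := by
      intro i hi
      by_contra h6
      exact hne (Finset.prod_eq_zero (Finset.mem_univ i) (by rw [h2 i hi, if_neg h6]))
    -- Polar factors are orthogonal only for equal lower indices. So equality spreads backwards: ν =
    -- ν' settles the last index, and each index settles the one before it.
    have h7 : ∀ i, a.1.1 i = b.1.1 i := by
      intro i
      induction i using Fin.reverseInduction with
      | last => exact h5 _ (by simp [hν])
      | cast i ih => exact h5 _ (by simpa using ih)
    exact hab (Subtype.ext (Prod.ext (funext h7) hν))

theorem infoMatrix_uniformDesign (n d : ℕ) :
    OptDesign.infoMatrix (regressors n d) (uniformDesign n) =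
      (1 / totalAngle n) • (1 : Matrix (Index n d) (Index n d) ℝ) := by
  ext a b
  rw [OptDesign.infoMatrix, Matrix.of_apply, integral_uniformDesign, setIntegral_regressors_mul,
    Matrix.smul_apply, Matrix.one_apply, one_div, smul_eq_mul]

theorem integrable_regressors_mul {n d : ℕ} {η : Measure (Angles n)}
    (hη : OptDesign.IsDesign (angleBox n) η) (a b : Index n d) :
    Integrable (fun x => regressors n d a x * regressors n d b x) η := by
  have := hη.1
  have h := ((continuous_regressors a).mul
    (continuous_regressors b)).continuousOn.integrableOn_compact (μ := η) (isCompact_angleBox n)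
  have hr : η.restrict (angleBox n) = η := Measure.restrict_eq_self_of_ae_mem (mem_ae_iff.2 hη.2)
  rwa [IntegrableOn, hr] at h

/-! ### The selected levels and the matrix K. -/

theorem sum_level_eq {n d l : ℕ} (hl : l ≤ d) (g : (Fin (n + 1) → ℕ) × ℤ → ℝ) :
    ∑ a : {a : Index n d // level a = l}, g a.1.1 = ∑ a ∈ levelSet n l, g a := by
  rw [← filter_indexSet_eq_levelSet hl, Finset.sum_filter, ← Finset.sum_coe_sort (indexSet n d),
    ← Finset.sum_subtype (Finset.univ.filter fun a : Index n d => level a = l) (by simp)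
      (fun a => g a.1), Finset.sum_filter]
  rfl

theorem card_level {n d l : ℕ} (hl : l ≤ d) :
    Fintype.card {a : Index n d // level a = l} = levelDim (n + 3) l := by
  have h := sum_level_eq (n := n) hl fun _ => 1
  rw [← card_levelSet]
  simpa only [Finset.sum_const, nsmul_eq_mul, mul_one, Finset.card_univ, Nat.cast_inj] using h

theorem card_index (n d : ℕ) :
    Fintype.card (Index n d) = ∑ l ∈ Finset.range (d + 1), levelDim (n + 3) l := by
  rw [Fintype.card_coe, Finset.card_eq_sum_card_fiberwise (f := fun a => a.1 0)
    (t := Finset.range (d + 1))]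
  · refine Finset.sum_congr rfl fun l hl => ?_
    rw [Finset.mem_range] at hl
    rw [filter_indexSet_eq_levelSet (by omega), card_levelSet]
  · intro a ha
    have := (mem_indexSet.1 ha).1
    simp only [Finset.coe_range, Set.mem_Iio]
    omega

theorem card_selected {n d q : ℕ} {k : Fin (q + 1) → ℕ} (hk : ∀ j, k j ≤ d) :
    Fintype.card (Selected n d k) = ∑ j, levelDim (n + 3) (k j) := by
  rw [Fintype.card_sigma]
  exact Finset.sum_congr rfl fun j _ => card_level (hk j)

/-- On each level the integrand is constant by the addition theorem, so only the total mass 1 of η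
enters. This is the trace bound for both (ii) and (iii). -/
theorem sum_selected_infoMatrix {n d q : ℕ} {k : Fin (q + 1) → ℕ} (hk : ∀ j, k j ≤ d)
    {η : Measure (Angles n)} (hη : OptDesign.IsDesign (angleBox n) η) :
    ∑ b : Selected n d k, OptDesign.infoMatrix (regressors n d) η b.2.1 b.2.1 =
      Fintype.card (Selected n d k) * (1 / totalAngle n) := by
  have := hη.1
  rw [card_selected hk, Fintype.sum_sigma]
  push_cast
  rw [Finset.sum_mul]
  refine Finset.sum_congr rfl fun j _ => ?_
  simp only [OptDesign.infoMatrix, Matrix.of_apply]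
  rw [← integral_finsetSum _ fun a _ => integrable_regressors_mul hη a.1 a.1]
  have h : ∀ x, ∑ a : {a : Index n d // level a = k j},
      regressors n d a.1 x * regressors n d a.1 x = levelDim (n + 3) (k j) / totalAngle n := by
    intro x
    rw [← sum_levelSet_hyperHarmonic_sq n (k j) x,
      ← sum_level_eq (hk j) fun a => hyperHarmonic n a.1 a.2 x ^ 2]
    refine Finset.sum_congr rfl fun a _ => ?_
    rw [sq]
    rfl
  simp_rw [h]
  simp
  ring

theorem selected_val_injective {n d q : ℕ} {k : Fin (q + 1) → ℕ} (hk : StrictMono k) :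
    Function.Injective fun b : Selected n d k => b.2.1 := by
  rintro ⟨j, a, ha⟩ ⟨j', a', ha'⟩ h
  simp only at h
  subst h
  obtain rfl : j = j' := hk.injective (ha.symm.trans ha')
  rfl

theorem selection_transpose_mul_mul {n d q : ℕ} (k : Fin (q + 1) → ℕ)
    (M : Matrix (Index n d) (Index n d) ℝ) (b b' : Selected n d k) :
    ((selection n d k).transpose * M * selection n d k) b b' = M b.2.1 b'.2.1 := by
  simp [Matrix.mul_apply, selection, Matrix.transpose_apply]

theorem selection_transpose_mul_self {n d q : ℕ} {k : Fin (q + 1) → ℕ} (hk : StrictMono k) :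
    (selection n d k).transpose * selection n d k = 1 := by
  ext b b'
  have h := selection_transpose_mul_mul k 1 b b'
  rw [Matrix.mul_one] at h
  rw [h, Matrix.one_apply, Matrix.one_apply]
  simp only [(selected_val_injective hk).eq_iff]

end Hyperspherical

open Hyperspherical in
theorem theorem3p1 (m n d : ℕ) (hm : m = n + 3) :
    -- the number `D` of regression functions
    Fintype.card (Hyperspherical.Index n d) =
        ∑ l ∈ Finset.range (d + 1), Hyperspherical.levelDim m l ∧
    -- the normalising constant
    Hyperspherical.totalAngle n =
        (2 * (Nat.doubleFactorial (m - 2) : ℝ) * Real.pi ^ ((m : ℝ) / 2) /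
          Real.Gamma ((m : ℝ) / 2)) / (Nat.doubleFactorial (m - 2) : ℝ) ∧
    -- the uniform distribution is a design
    OptDesign.IsDesign (Hyperspherical.angleBox n) (Hyperspherical.uniformDesign n) ∧
    -- (i)
    OptDesign.infoMatrix (Hyperspherical.regressors n d) (Hyperspherical.uniformDesign n) =
        (1 / Hyperspherical.totalAngle n) •
          (1 : Matrix (Hyperspherical.Index n d) (Hyperspherical.Index n d) ℝ) ∧
    ∀ (q : ℕ) (k : Fin (q + 1) → ℕ), StrictMono k → (∀ j, k j ≤ d) →
      -- the number of columns of `K`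
      Fintype.card (Hyperspherical.Selected n d k) =
          ∑ j, Hyperspherical.levelDim m (k j) ∧
      -- (ii)
      (∀ p : EReal, p < 1 →
        OptDesign.IsPhiOptimal (Hyperspherical.regressors n d) (Hyperspherical.angleBox n)
          (Hyperspherical.selection n d k) p (Hyperspherical.uniformDesign n)) ∧
      -- (iii)
      OptDesign.IsPhiEOptimal (Hyperspherical.regressors n d) (Hyperspherical.angleBox n)
        (∑ j, Hyperspherical.levelDim m (k j)) (Hyperspherical.uniformDesign n) := by
  subst hm
  have hM := infoMatrix_uniformDesign n d
  have hD := isDesign_uniformDesign n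
  have hc : 0 < 1 / totalAngle n := one_div_pos.2 (totalAngle_pos n)
  refine ⟨card_index n d, ?_, hD, hM, fun q k hk hkd => ⟨card_selected hkd, fun p hp => ?_, ?_⟩⟩
  · have : (Nat.doubleFactorial (n + 3 - 2) : ℝ) ≠ 0 := by
      exact_mod_cast (Nat.doubleFactorial_pos _).ne'
    rw [totalAngle_eq_Gamma]
    field_simp
  · have hne : Nonempty (Selected n d k) := by
      rw [← Fintype.card_pos_iff, card_selected hkd]
      exact Finset.sum_pos (fun j _ => levelDim_pos n _) Finset.univ_nonempty
    refine OptDesign.isPhiOptimal_of_trace_le hc hD hM (selection_transpose_mul_self hk)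
      (fun η hη => integrable_regressors_mul hη) (fun η hη => ?_) hp
    rw [← sum_selected_infoMatrix hkd hη]
    refine (Finset.sum_congr rfl fun b _ => ?_).le
    exact selection_transpose_mul_mul k _ b b
  · rw [← card_selected hkd]
    have hle : Fintype.card (Selected n d k) ≤ Fintype.card (Index n d) :=
      Fintype.card_le_of_injective _ (selected_val_injective hk)
    refine ⟨⟨?_, hle⟩, hD, fun η hη => ?_⟩
    · rw [card_selected hkd]
      exact Finset.sum_pos (fun j _ => levelDim_pos n _) Finset.univ_nonempty
    -- Ky Fan's inequality for the diagonal entries at the selected indices, which are distinct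
    -- because the levels are.
    · have h := OptDesign.phiE_le_sum_diag (regressors n d) η
        (Finset.univ.map ⟨_, selected_val_injective hk⟩)
      rw [Finset.card_map, Finset.sum_map, Finset.card_univ] at h
      rw [OptDesign.phiE_of_infoMatrix_eq_smul_one hM hle]
      exact h.trans (sum_selected_infoMatrix hkd hη).le
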